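/- Let $M$ be a connected oriented smooth manifold of even dimension $n=2m\ge 4$, and let $g$, $\widetilde g$ be two smooth Riemannian metrics on $M$. For a metric $h$ on $M$, let $\mathcal Z_h\subset \mathrm{Hom}(TM,TM)$ be the (positive) twistor space of $(M,h)$: its fibre over $p\in M$ consists of all $h$-orthogonal complex structures $J$ on $T_pM$ ($J^2=-\mathrm{Id}$) which induce the orientation of $T_pM$. The Levi-Civita connection of $h$ gives a splitting $T\mathcal Z_h=\mathcal H\oplus\mathcal V$ into horizontal and vertical parts, where $\mathcal V_J$ consists of the $h$-skew-symmetric endomorphisms $U$ of $T_pM$ with $UJ=-JU$; writing $X^h_J\in\mathcal H_J$ for the horizontal lift of $X\in T_pM$, the Eells–Salamon almost complex structure is $$\mathcal J_2(X^h_J+U)=(JX)^h_J-J\circ U .$$ Put $\mathcal Z=\mathcal Z_g$ and $\widetilde{\mathcal Z}=\mathcal Z_{\widetilde g}$, with their Eells–Salamon almost complex structures $\mathcal J_2$ and $\widetilde{\mathcal J}_2$. Let $C$ be the endomorphism of $TM$ with $g(CX,Y)=\widetilde g(X,Y)$, let $Q$ be its principal square root (the $g$-symmetric positive endomorphism with $Q^2=C$),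 and let $\Psi:\mathcal Z\to\widetilde{\mathcal Z}$, $\Psi(J)=Q^{-1}JQ$. A smooth map $\varphi$ between almost complex manifolds is called holomorphic if its differential commutes with the almost complex structures ($\widetilde J\circ\varphi_*=\varphi_*\circ J$), and anti-holomorphic if $\widetilde J\circ\varphi_*=-\varphi_*\circ J$. Then: (i) $\Psi:(\mathcal Z,\mathcal J_2)\to(\widetilde{\mathcal Z},\widetilde{\mathcal J}_2)$ is holomorphic if and only if $g$ and $\widetilde g$ are homothetic, i.e. $\widetilde g=e^{2f}g$ for a constant $f\in\mathbb R$; in this case $\mathcal Z=\widetilde{\mathcal Z}$ and $\Psi=\mathrm{Id}$. (ii) $\Psi:(\mathcal Z,\mathcal J_2)\to(\widetilde{\mathcal Z},\widetilde{\mathcal J}_2)$ is never anti-holomorphic. -/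

import Mathlib

open scoped Manifold ContDiff

namespace TwistorGeometry

section LinearAlgebra

theorem existsUnique_sqrt_of_inner {V : Type*} [NormedAddCommGroup V] [InnerProductSpace ℝ V]
    [FiniteDimensional ℝ V] (C : V →ₗ[ℝ] V) (hC : C.IsSymmetric)
    (hpos : ∀ v, v ≠ 0 → 0 < inner ℝ (C v) v) :
    ∃! Q : V →ₗ[ℝ] V, Q.IsSymmetric ∧ (∀ v, v ≠ 0 → 0 < inner ℝ (Q v) v) ∧ Q ∘ₗ Q = C := by
  set b := hC.eigenvectorBasis rfl with hb
  set μ := hC.eigenvalues rfl with hμ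
  have hCb : ∀ i, C (b i) = μ i • b i := fun i => hC.apply_eigenvectorBasis rfl i
  have hμpos : ∀ i, 0 < μ i := by
    intro i
    have h0 : b i ≠ 0 := b.orthonormal.ne_zero i
    have h := hpos (b i) h0
    rw [hCb, inner_smul_left] at h
    have h1 : inner ℝ (b i) (b i) = (1 : ℝ) := by simp
    rw [h1] at h
    simp at h
    exact h
  let Q : V →ₗ[ℝ] V := b.toBasis.constr ℝ (fun i => Real.sqrt (μ i) • b i)
  have hQb : ∀ i, Q (b i) = Real.sqrt (μ i) • b i := by
    intro i
    have := b.toBasis.constr_basis ℝ (fun i => Real.sqrt (μ i) • b i) i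
    rw [OrthonormalBasis.coe_toBasis] at this
    exact this
  have hQinner : ∀ v w, inner ℝ (Q v) w =
      ∑ i, Real.sqrt (μ i) * (inner ℝ (b i) v * inner ℝ (b i) w) := by
    intro v w
    conv_lhs => rw [← b.sum_repr v]
    simp only [map_sum, map_smul, hQb, sum_inner, inner_smul_left, b.repr_apply_apply]
    refine Finset.sum_congr rfl fun i _ => ?_
    simp
    ring
  refine ⟨Q, ⟨?_, ?_, ?_⟩, ?_⟩
  · intro v w
    rw [← real_inner_comm v (Q w), hQinner, hQinner]
    exact Finset.sum_congr rfl fun i _ => by ring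
  · intro v hv
    rw [hQinner]
    have h0 : ∀ i ∈ Finset.univ, 0 ≤ Real.sqrt (μ i) * (inner ℝ (b i) v * inner ℝ (b i) v) :=
      fun i _ => mul_nonneg (Real.sqrt_nonneg _) (mul_self_nonneg _)
    refine lt_of_le_of_ne (Finset.sum_nonneg h0) fun h => hv ?_
    have h2 := (Finset.sum_eq_zero_iff_of_nonneg h0).1 h.symm
    refine b.toBasis.ext_elem fun i => ?_
    have h3 := h2 i (Finset.mem_univ _)
    have h4 := (Real.sqrt_pos.2 (hμpos i)).ne'
    simpa [h4, b.repr_apply_apply] using h3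
  · refine b.toBasis.ext fun i => ?_
    simp [hQb, hCb, smul_smul, Real.mul_self_sqrt (hμpos i).le]
  · rintro P ⟨hPs, hPpos, hP⟩
    have hQs : Q.IsSymmetric := by
      intro v w
      rw [← real_inner_comm v (Q w), hQinner, hQinner]
      exact Finset.sum_congr rfl fun i _ => by ring
    have hPb : ∀ i, P (b i) = Q (b i) := by
      intro i
      by_contra hne
      set u := P (b i) - Q (b i) with hu
      have hu0 : u ≠ 0 := sub_ne_zero.2 hne
      have hPP : P (P (b i)) = μ i • b i := by
        rw [← hCb, ← hP]; rfl
      have h1 : P u = - (Real.sqrt (μ i) • u) := by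
        rw [hu, map_sub, hPP, hQb, map_smul, smul_sub, smul_smul, Real.mul_self_sqrt (hμpos i).le]
        abel
      have h2 := hPpos u hu0
      rw [h1, inner_neg_left, inner_smul_left] at h2
      have h3 : 0 ≤ Real.sqrt (μ i) * inner ℝ u u :=
        mul_nonneg (Real.sqrt_nonneg _) real_inner_self_nonneg
      simp at h2
      simp at h3
      linarith
    exact b.toBasis.ext fun i => by simpa using hPb i

/-- The principal square root: a positive symmetric operator has a unique positive symmetric
square root. The inner product is an arbitrary positive definite symmetric bilinear form `B`. -/
theorem existsUnique_sqrt {V : Type*} [AddCommGroup V] [Module ℝ V] [FiniteDimensional ℝ V]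
    (B : V →ₗ[ℝ] V →ₗ[ℝ] ℝ) (hB : ∀ v w, B v w = B w v) (hBpos : ∀ v, v ≠ 0 → 0 < B v v)
    (C : V →ₗ[ℝ] V) (hC : ∀ v w, B (C v) w = B v (C w)) (hpos : ∀ v, v ≠ 0 → 0 < B (C v) v) :
    ∃! Q : V →ₗ[ℝ] V, (∀ v w, B (Q v) w = B v (Q w)) ∧ (∀ v, v ≠ 0 → 0 < B (Q v) v) ∧
      Q ∘ₗ Q = C := by
  let core : InnerProductSpace.Core ℝ V :=
    { inner := fun v w => B v w
      conj_inner_symm := fun v w => hB w v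
      re_inner_nonneg := fun v => by
        by_cases h : v = 0
        · simp [h]
        · exact (hBpos v h).le
      add_left := fun u v w => by simp
      smul_left := fun u v r => by simp
      definite := fun v h => by
        by_contra h0
        exact (hBpos v h0).ne' h }
  let _ : NormedAddCommGroup V := core.toNormedAddCommGroup
  let _ : InnerProductSpace ℝ V := InnerProductSpace.ofCore core.toCore
  exact existsUnique_sqrt_of_inner C hC hpos

theorem det_pos_of_symm_pos {V : Type*} [AddCommGroup V] [Module ℝ V] [FiniteDimensional ℝ V]
    (B : V →ₗ[ℝ] V →ₗ[ℝ] ℝ) (hB : ∀ v w, B v w = B w v) (hBpos : ∀ v, v ≠ 0 → 0 < B v v)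
    (C : V →ₗ[ℝ] V) (hC : ∀ v w, B (C v) w = B v (C w)) (hpos : ∀ v, v ≠ 0 → 0 < B (C v) v) :
    0 < LinearMap.det C := by
  obtain ⟨Q, ⟨-, -, hQ⟩, -⟩ := existsUnique_sqrt B hB hBpos C hC hpos
  have hker : LinearMap.ker C = ⊥ := by
    rw [LinearMap.ker_eq_bot']
    intro v hv
    by_contra h
    have := hpos v h
    simp [hv] at this
  have h1 : LinearMap.det C ≠ 0 := by
    intro h
    exact absurd hker (LinearMap.bot_lt_ker_of_det_eq_zero h).ne'
  have h2 : LinearMap.det C = LinearMap.det Q * LinearMap.det Q := by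
    rw [← hQ, LinearMap.det_comp]
  rw [h2] at h1 ⊢
  exact lt_of_le_of_ne (mul_self_nonneg _) h1.symm

end LinearAlgebra

section Metric

open Bundle VectorField FiberBundle

instance instT2SpaceTangent {n : ℕ} {M : Type*} [TopologicalSpace M]
    [ChartedSpace (EuclideanSpace ℝ (Fin n)) M] (p : M) : T2Space (TangentSpace (𝓡 n) p) :=
  inferInstanceAs (T2Space (EuclideanSpace ℝ (Fin n)))

instance instFiniteDimensionalTangent {n : ℕ} {M : Type*} [TopologicalSpace M]
    [ChartedSpace (EuclideanSpace ℝ (Fin n)) M] (p : M) :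
    FiniteDimensional ℝ (TangentSpace (𝓡 n) p) :=
  inferInstanceAs (FiniteDimensional ℝ (EuclideanSpace ℝ (Fin n)))

/-! ### Riemannian metrics and the Levi-Civita connection -/

/-- Smooth Riemannian metrics on an `n`-dimensional manifold `M`. -/
abbrev RMetric (n : ℕ) (M : Type*) [TopologicalSpace M]
    [ChartedSpace (EuclideanSpace ℝ (Fin n)) M] [IsManifold (𝓡 n) ∞ M] :=
  ContMDiffRiemannianMetric (𝓡 n) ∞ (EuclideanSpace ℝ (Fin n))
    (fun p : M => TangentSpace (𝓡 n) p)

theorem finrank_dual_tangent {n : ℕ} {M : Type*} [TopologicalSpace M]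
    [ChartedSpace (EuclideanSpace ℝ (Fin n)) M] (p : M) :
    Module.finrank ℝ (TangentSpace (𝓡 n) p) = Module.finrank ℝ (TangentSpace (𝓡 n) p →L[ℝ] ℝ) := by
  rw [← LinearEquiv.finrank_eq (LinearMap.toContinuousLinearMap
    (𝕜 := ℝ) (E := TangentSpace (𝓡 n) p) (F' := ℝ))]
  exact (Subspace.dual_finrank_eq (K := ℝ) (V := TangentSpace (𝓡 n) p)).symm

variable {n : ℕ} {M : Type*} [TopologicalSpace M]
    [ChartedSpace (EuclideanSpace ℝ (Fin n)) M] [IsManifold (𝓡 n) ∞ M]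

theorem flat_injective (g : RMetric n M) (p : M) :
    Function.Injective (g.inner p : TangentSpace (𝓡 n) p →ₗ[ℝ] TangentSpace (𝓡 n) p →L[ℝ] ℝ) := by
  rw [← LinearMap.ker_eq_bot, LinearMap.ker_eq_bot']
  intro v hv
  by_contra h
  have h1 := g.pos p v h
  have h2 : g.inner p v = 0 := hv
  rw [h2] at h1
  simp at h1

/-- The isomorphism `v ↦ g(v, ·)` of the tangent space onto its dual. -/
noncomputable def flat (g : RMetric n M) (p : M) :
    TangentSpace (𝓡 n) p ≃ₗ[ℝ] (TangentSpace (𝓡 n) p →L[ℝ] ℝ) :=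
  have : FiniteDimensional ℝ (TangentSpace (𝓡 n) p →L[ℝ] ℝ) :=
    LinearEquiv.finiteDimensional (LinearMap.toContinuousLinearMap
      (𝕜 := ℝ) (E := TangentSpace (𝓡 n) p) (F' := ℝ))
  LinearEquiv.ofInjectiveOfFinrankEq
    (g.inner p : TangentSpace (𝓡 n) p →ₗ[ℝ] TangentSpace (𝓡 n) p →L[ℝ] ℝ)
    (flat_injective g p) (finrank_dual_tangent p)

theorem flat_apply (g : RMetric n M) (p : M) (v : TangentSpace (𝓡 n) p) :
    flat g p v = g.inner p v := rfl

theorem inner_flat_symm (g : RMetric n M) (p : M) (φ : TangentSpace (𝓡 n) p →L[ℝ] ℝ) :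
    g.inner p ((flat g p).symm φ) = φ := by
  rw [← flat_apply, LinearEquiv.apply_symm_apply]

/-- Differentiability of a vector field at a point. -/
abbrev DiffAt (X : Π p : M, TangentSpace (𝓡 n) p) (p : M) : Prop :=
  MDifferentiableAt (𝓡 n) ((𝓡 n).prod 𝓘(ℝ, EuclideanSpace ℝ (Fin n)))
    (fun q => TotalSpace.mk' (EuclideanSpace ℝ (Fin n)) q (X q)) p

theorem mdifferentiableAt_inner (g : RMetric n M) {X Y : Π p : M, TangentSpace (𝓡 n) p} {p : M}
    (hX : DiffAt X p) (hY : DiffAt Y p) :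
    MDifferentiableAt (𝓡 n) 𝓘(ℝ) (fun q => g.inner q (X q) (Y q)) p := by
  have : MDifferentiableAt (𝓡 n) ((𝓡 n).prod 𝓘(ℝ))
      (fun m ↦ TotalSpace.mk' ℝ (E := Bundle.Trivial M ℝ) m (g.inner m (X m) (Y m))) p := by
    apply MDifferentiableAt.clm_bundle_apply₂ (F₁ := EuclideanSpace ℝ (Fin n))
      (F₂ := EuclideanSpace ℝ (Fin n))
    · exact g.contMDiff.mdifferentiableAt (by simp)
    · exact hX
    · exact hY
  simp only [mdifferentiableAt_totalSpace] at this
  exact this.2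

/-- The right-hand side of the Koszul formula for `2 g(∇_X Y, Z)`. -/
noncomputable def koszul (g : RMetric n M) (X Y Z : Π p : M, TangentSpace (𝓡 n) p) (p : M) : ℝ :=
  mvfderiv (𝓡 n) (fun q => g.inner q (Y q) (Z q)) p (X p) + mvfderiv (𝓡 n) (fun q => g.inner q (X q) (Z q)) p (Y p)
    - mvfderiv (𝓡 n) (fun q => g.inner q (X q) (Y q)) p (Z p)
    + g.inner p (mlieBracket (𝓡 n) X Y p) (Z p) - g.inner p (mlieBracket (𝓡 n) X Z p) (Y p)
    - g.inner p (mlieBracket (𝓡 n) Y Z p) (X p)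

theorem d_inner_add_left (g : RMetric n M) {X X' Y : Π p : M, TangentSpace (𝓡 n) p} {p : M}
    (hX : DiffAt X p) (hX' : DiffAt X' p) (hY : DiffAt Y p) :
    mvfderiv (𝓡 n) (fun q => g.inner q ((X + X') q) (Y q)) p =
      mvfderiv (𝓡 n) (fun q => g.inner q (X q) (Y q)) p + mvfderiv (𝓡 n) (fun q => g.inner q (X' q) (Y q)) p := by
  have h := mvfderiv_fun_add (mdifferentiableAt_inner g hX hY) (mdifferentiableAt_inner g hX' hY)
  simpa using h

theorem d_inner_smul_left (g : RMetric n M) {f : M → ℝ} {X Y : Π p : M, TangentSpace (𝓡 n) p}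
    {p : M} (hf : MDifferentiableAt (𝓡 n) 𝓘(ℝ) f p) (hX : DiffAt X p) (hY : DiffAt Y p) :
    mvfderiv (𝓡 n) (fun q => g.inner q ((f • X) q) (Y q)) p =
      f p • mvfderiv (𝓡 n) (fun q => g.inner q (X q) (Y q)) p + g.inner p (X p) (Y p) • mvfderiv (𝓡 n) f p := by
  have h := mvfderiv_fun_mul hf (mdifferentiableAt_inner g hX hY)
  simpa using h

theorem inner_comm_fun (g : RMetric n M) (X Y : Π p : M, TangentSpace (𝓡 n) p) :
    (fun q => g.inner q (X q) (Y q)) = fun q => g.inner q (Y q) (X q) :=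
  funext fun q => g.symm q _ _

theorem d_inner_add_right (g : RMetric n M) {X X' Y : Π p : M, TangentSpace (𝓡 n) p} {p : M}
    (hX : DiffAt X p) (hX' : DiffAt X' p) (hY : DiffAt Y p) :
    mvfderiv (𝓡 n) (fun q => g.inner q (Y q) ((X + X') q)) p =
      mvfderiv (𝓡 n) (fun q => g.inner q (Y q) (X q)) p + mvfderiv (𝓡 n) (fun q => g.inner q (Y q) (X' q)) p := by
  rw [inner_comm_fun g Y (X + X'), inner_comm_fun g Y X, inner_comm_fun g Y X',
    d_inner_add_left g hX hX' hY]

theorem d_inner_smul_right (g : RMetric n M) {f : M → ℝ} {X Y : Π p : M, TangentSpace (𝓡 n) p}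
    {p : M} (hf : MDifferentiableAt (𝓡 n) 𝓘(ℝ) f p) (hX : DiffAt X p) (hY : DiffAt Y p) :
    mvfderiv (𝓡 n) (fun q => g.inner q (Y q) ((f • X) q)) p =
      f p • mvfderiv (𝓡 n) (fun q => g.inner q (Y q) (X q)) p + g.inner p (Y p) (X p) • mvfderiv (𝓡 n) f p := by
  rw [inner_comm_fun g Y (f • X), inner_comm_fun g Y X, d_inner_smul_left g hf hX hY,
    g.symm p (X p)]

theorem koszul_tensorial_left (g : RMetric n M) {Y Z : Π p : M, TangentSpace (𝓡 n) p} {p : M}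
    (hY : DiffAt Y p) (hZ : DiffAt Z p) :
    TensorialAt (𝓡 n) (EuclideanSpace ℝ (Fin n)) (koszul g · Y Z p) p where
  smul {f X} hf hX := by
    simp only [koszul, d_inner_smul_left g hf hX hZ, d_inner_smul_left g hf hX hY, mlieBracket_smul_left hf hX]
    simp only [map_add, map_smul, map_neg, neg_smul, Pi.smul_apply', smul_eq_mul, _root_.add_apply, _root_.smul_apply, _root_.neg_apply]
    ring
  add {X X'} hX hX' := by
    simp only [koszul, d_inner_add_left g hX hX' hZ, d_inner_add_left g hX hX' hY, mlieBracket_add_left hX hX']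
    simp only [map_add, Pi.add_apply, _root_.add_apply]
    ring

theorem koszul_tensorial_right (g : RMetric n M) {X Y : Π p : M, TangentSpace (𝓡 n) p} {p : M}
    (hX : DiffAt X p) (hY : DiffAt Y p) :
    TensorialAt (𝓡 n) (EuclideanSpace ℝ (Fin n)) (koszul g X Y · p) p where
  smul {f Z} hf hZ := by
    simp only [koszul, d_inner_smul_right g hf hZ hX, d_inner_smul_right g hf hZ hY, mlieBracket_smul_right hf hZ]
    simp only [map_add, map_smul, Pi.smul_apply', smul_eq_mul, _root_.add_apply, _root_.smul_apply, g.symm p (Z p)]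
    ring
  add {Z Z'} hZ hZ' := by
    simp only [koszul, d_inner_add_right g hZ hZ' hX, d_inner_add_right g hZ hZ' hY, mlieBracket_add_right hZ hZ']
    simp only [map_add, Pi.add_apply, _root_.add_apply]
    ring

open scoped Classical in
/-- The bilinear form `(X, Z) ↦ 2 g(∇_X Y, Z)` at `p` (zero where `Y` is not differentiable). -/
noncomputable def koszulForm (g : RMetric n M) (Y : Π p : M, TangentSpace (𝓡 n) p) (p : M) :
    TangentSpace (𝓡 n) p →L[ℝ] TangentSpace (𝓡 n) p →L[ℝ] ℝ :=
  if hY : DiffAt Y p then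
    TensorialAt.mkHom₂ (fun X Z => koszul g X Y Z p) p
      (fun _ hZ => koszul_tensorial_left g hY hZ) (fun _ hX => koszul_tensorial_right g hX hY)
  else 0

theorem koszulForm_apply (g : RMetric n M) {X Y Z : Π p : M, TangentSpace (𝓡 n) p} {p : M}
    (hX : DiffAt X p) (hY : DiffAt Y p) (hZ : DiffAt Z p) :
    koszulForm g Y p (X p) (Z p) = koszul g X Y Z p := by
  rw [koszulForm, dif_pos hY]
  exact TensorialAt.mkHom₂_apply _ _ hX hZ

/-- `nabla g Y p v` is `∇_v Y`, where `2 g(∇_v Y, w)` is given by the Koszul formula. -/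
noncomputable def nabla (g : RMetric n M) (Y : Π p : M, TangentSpace (𝓡 n) p) (p : M) :
    TangentSpace (𝓡 n) p →L[ℝ] TangentSpace (𝓡 n) p :=
  LinearMap.toContinuousLinearMap
    ((2⁻¹ : ℝ) • ((flat g p).symm.toLinearMap ∘ₗ (koszulForm g Y p).toLinearMap))

theorem inner_nabla (g : RMetric n M) (Y : Π p : M, TangentSpace (𝓡 n) p) (p : M)
    (v w : TangentSpace (𝓡 n) p) :
    g.inner p (nabla g Y p v) w = 2⁻¹ * koszulForm g Y p v w := by
  have h : nabla g Y p v = (2⁻¹ : ℝ) • (flat g p).symm (koszulForm g Y p v) := rfl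
  rw [h, map_smul, inner_flat_symm]
  rfl

theorem ext_inner (g : RMetric n M) (p : M) {u v : TangentSpace (𝓡 n) p}
    (h : ∀ w, g.inner p u w = g.inner p v w) : u = v :=
  flat_injective g p (ContinuousLinearMap.ext h)

theorem nabla_ext (g : RMetric n M) (p : M)
    {A B : TangentSpace (𝓡 n) p →L[ℝ] TangentSpace (𝓡 n) p}
    (h : ∀ X Z : Π p : M, TangentSpace (𝓡 n) p, DiffAt X p → DiffAt Z p →
      g.inner p (A (X p)) (Z p) = g.inner p (B (X p)) (Z p)) : A = B := by
  ext1 v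
  refine ext_inner g p fun w => ?_
  have := h (extend (EuclideanSpace ℝ (Fin n)) v) (extend (EuclideanSpace ℝ (Fin n)) w)
    (mdifferentiableAt_extend ..) (mdifferentiableAt_extend ..)
  simpa using this

/-- The Levi-Civita connection of a Riemannian metric. -/
noncomputable def leviCivita (g : RMetric n M) :
    CovariantDerivative (𝓡 n) (EuclideanSpace ℝ (Fin n)) (fun p : M => TangentSpace (𝓡 n) p) where
  toFun := nabla g
  isCovariantDerivativeOnUniv :=
    { add := by
        intro Y Y' p hY hY' _
        refine nabla_ext g p fun X Z hX hZ => ?_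
        rw [_root_.add_apply, map_add, _root_.add_apply, inner_nabla,
          inner_nabla, inner_nabla, koszulForm_apply g hX hY hZ, koszulForm_apply g hX hY' hZ,
          koszulForm_apply g hX (mdifferentiableAt_add_section hY hY') hZ]
        simp only [koszul, d_inner_add_left g hY hY' hZ, d_inner_add_right g hY hY' hX, mlieBracket_add_right hY hY', mlieBracket_add_left hY hY']
        simp only [map_add, Pi.add_apply, _root_.add_apply]
        ring
      leibniz := by
        intro Y f p hY hf _
        refine nabla_ext g p fun X Z hX hZ => ?_
        rw [_root_.add_apply, map_add, _root_.add_apply,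
          _root_.smul_apply, map_smul, _root_.smul_apply,
          ContinuousLinearMap.smulRight_apply, map_smul, _root_.smul_apply,
          inner_nabla, inner_nabla, koszulForm_apply g hX hY hZ,
          koszulForm_apply g hX (hf.smul_section hY) hZ]
        simp only [koszul, d_inner_smul_left g hf hY hZ, d_inner_smul_right g hf hY hX, mlieBracket_smul_right hf hY, mlieBracket_smul_left hf hY]
        simp only [map_add, map_smul, neg_smul, map_neg, Pi.smul_apply', smul_eq_mul, _root_.add_apply, _root_.smul_apply, _root_.neg_apply,
          g.symm p (Y p) (X p)]
        ring }

theorem leviCivita_torsion (g : RMetric n M) {X Y : Π p : M, TangentSpace (𝓡 n) p} {p : M}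
    (hX : DiffAt X p) (hY : DiffAt Y p) :
    leviCivita g Y p (X p) - leviCivita g X p (Y p) = mlieBracket (𝓡 n) X Y p := by
  refine ext_inner g p fun w => ?_
  set Z := extend (EuclideanSpace ℝ (Fin n)) w with hZdef
  have hZ : DiffAt Z p := mdifferentiableAt_extend ..
  have hw : w = Z p := by simp [hZdef]
  rw [map_sub, _root_.sub_apply]
  change g.inner p (nabla g Y p (X p)) w - g.inner p (nabla g X p (Y p)) w = _
  rw [inner_nabla, inner_nabla, hw, koszulForm_apply g hX hY hZ, koszulForm_apply g hY hX hZ]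
  simp only [koszul, inner_comm_fun g Y X]
  rw [mlieBracket_swap_apply (V := Y) (W := X), map_neg, _root_.neg_apply]
  ring

theorem leviCivita_metric (g : RMetric n M) {X Y Z : Π p : M, TangentSpace (𝓡 n) p} {p : M}
    (hX : DiffAt X p) (hY : DiffAt Y p) (hZ : DiffAt Z p) :
    mvfderiv (𝓡 n) (fun q => g.inner q (Y q) (Z q)) p (X p) =
      g.inner p (leviCivita g Y p (X p)) (Z p) + g.inner p (Y p) (leviCivita g Z p (X p)) := by
  change _ = g.inner p (nabla g Y p (X p)) (Z p) + g.inner p (Y p) (nabla g Z p (X p))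
  rw [g.symm p (Y p), inner_nabla, inner_nabla, koszulForm_apply g hX hY hZ,
    koszulForm_apply g hX hZ hY]
  simp only [koszul, inner_comm_fun g Z Y]
  rw [mlieBracket_swap_apply (V := Z) (W := Y), map_neg, _root_.neg_apply]
  ring


/-! ### The bundle of endomorphisms of the tangent bundle -/

/-- The total space of the vector bundle `Hom(TM, TM)`. -/
abbrev EndBundle (n : ℕ) (M : Type*) [TopologicalSpace M]
    [ChartedSpace (EuclideanSpace ℝ (Fin n)) M] [IsManifold (𝓡 n) ∞ M] :=
  TotalSpace (EuclideanSpace ℝ (Fin n) →L[ℝ] EuclideanSpace ℝ (Fin n))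
    (fun p : M => TangentSpace (𝓡 n) p →L[ℝ] TangentSpace (𝓡 n) p)

/-- The model with corners of the manifold `EndBundle n M`. -/
noncomputable abbrev modelEnd (n : ℕ) :=
  (𝓡 n).prod 𝓘(ℝ, EuclideanSpace ℝ (Fin n) →L[ℝ] EuclideanSpace ℝ (Fin n))

/-- Differentiability at a point of a section of `Hom(TM, TM)`. -/
abbrev EndDiffAt (S : Π p : M, TangentSpace (𝓡 n) p →L[ℝ] TangentSpace (𝓡 n) p) (p : M) : Prop :=
  MDifferentiableAt (𝓡 n) (modelEnd n) (fun q => (⟨q, S q⟩ : EndBundle n M)) p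

theorem endNabla_tensorial (g : RMetric n M)
    {S : Π p : M, TangentSpace (𝓡 n) p →L[ℝ] TangentSpace (𝓡 n) p} {p : M} (hS : EndDiffAt S p) :
    TensorialAt (𝓡 n) (EuclideanSpace ℝ (Fin n)) (fun Y : Π p : M, TangentSpace (𝓡 n) p =>
      leviCivita g (fun q => S q (Y q)) p - S p ∘L leviCivita g Y p) p where
  smul {f Y} hf hY := by
    have hSY : DiffAt (fun q => S q (Y q)) p := MDifferentiableAt.clm_bundle_apply hS hY
    have h1 : (fun q => S q ((f • Y) q)) = f • fun q => S q (Y q) := by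
      funext q
      simp
    have h2 := (leviCivita g).isCovariantDerivativeOnUniv.leibniz hSY hf
    have h3 := (leviCivita g).isCovariantDerivativeOnUniv.leibniz hY hf
    rw [h1, h2, h3]
    ext v
    simp
    module
  add {Y Y'} hY hY' := by
    have hSY : DiffAt (fun q => S q (Y q)) p := MDifferentiableAt.clm_bundle_apply hS hY
    have hSY' : DiffAt (fun q => S q (Y' q)) p := MDifferentiableAt.clm_bundle_apply hS hY'
    have h1 : (fun q => S q ((Y + Y') q)) = (fun q => S q (Y q)) + fun q => S q (Y' q) := by
      funext q
      simp
    have h2 := (leviCivita g).isCovariantDerivativeOnUniv.add hSY hSY'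
    have h3 := (leviCivita g).isCovariantDerivativeOnUniv.add hY hY'
    rw [h1, h2, h3]
    ext v
    simp
    abel

open scoped Classical in
/-- The bilinear map `(Y, X) ↦ (∇_X S) Y = ∇_X (S Y) - S (∇_X Y)` at `p`
(zero where `S` is not differentiable). -/
noncomputable def endNablaForm (g : RMetric n M)
    (S : Π p : M, TangentSpace (𝓡 n) p →L[ℝ] TangentSpace (𝓡 n) p) (p : M) :
    TangentSpace (𝓡 n) p →L[ℝ] TangentSpace (𝓡 n) p →L[ℝ] TangentSpace (𝓡 n) p :=
  if hS : EndDiffAt S p then TensorialAt.mkHom _ p (endNabla_tensorial g hS) else 0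

/-- The connection induced by the Levi-Civita connection on `Hom(TM, TM)`:
`endNabla g S p v` is the endomorphism `∇_v S` of the tangent space at `p`. -/
noncomputable def endNabla (g : RMetric n M)
    (S : Π p : M, TangentSpace (𝓡 n) p →L[ℝ] TangentSpace (𝓡 n) p) (p : M) :
    TangentSpace (𝓡 n) p →ₗ[ℝ] (TangentSpace (𝓡 n) p →L[ℝ] TangentSpace (𝓡 n) p) :=
  LinearMap.toContinuousLinearMap.toLinearMap ∘ₗ
    (ContinuousLinearMap.coeLM ℝ ∘ₗ (endNablaForm g S p).toLinearMap).flip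

theorem endNabla_apply (g : RMetric n M)
    {S : Π p : M, TangentSpace (𝓡 n) p →L[ℝ] TangentSpace (𝓡 n) p}
    {Y : Π p : M, TangentSpace (𝓡 n) p} {p : M} (hS : EndDiffAt S p) (hY : DiffAt Y p)
    (v : TangentSpace (𝓡 n) p) :
    endNabla g S p v (Y p) =
      leviCivita g (fun q => S q (Y q)) p v - S p (leviCivita g Y p v) := by
  have h : endNabla g S p v (Y p) = endNablaForm g S p (Y p) v := rfl
  rw [h, endNablaForm, dif_pos hS, TensorialAt.mkHom_apply (endNabla_tensorial g hS) hY]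
  rfl

/-- The vertical lift of `U` at `J`: the velocity of `t ↦ J + t U` at `t = 0`. -/
noncomputable def vertLift (J : EndBundle n M)
    (U : TangentSpace (𝓡 n) J.1 →L[ℝ] TangentSpace (𝓡 n) J.1) :
    TangentSpace (modelEnd n) J :=
  mfderiv 𝓘(ℝ, ℝ) (modelEnd n) (fun t : ℝ => (⟨J.1, J.2 + t • U⟩ : EndBundle n M)) 0 (1 : ℝ)

/-- The trivialization of `Hom(TM, TM)` around `p`, on the fibre over `p`. -/
noncomputable def fibreCoord (p : M) : (TangentSpace (𝓡 n) p →L[ℝ] TangentSpace (𝓡 n) p) ≃L[ℝ]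
    (EuclideanSpace ℝ (Fin n) →L[ℝ] EuclideanSpace ℝ (Fin n)) :=
  (trivializationAt (EuclideanSpace ℝ (Fin n) →L[ℝ] EuclideanSpace ℝ (Fin n))
    (fun p : M => TangentSpace (𝓡 n) p →L[ℝ] TangentSpace (𝓡 n) p) p).continuousLinearEquivAt ℝ p
    (FiberBundle.mem_baseSet_trivializationAt' p)

theorem hasMFDerivAt_vert (J : EndBundle n M)
    (U : TangentSpace (𝓡 n) J.1 →L[ℝ] TangentSpace (𝓡 n) J.1) :
    HasMFDerivAt 𝓘(ℝ, ℝ) (modelEnd n) (fun t : ℝ => (⟨J.1, J.2 + t • U⟩ : EndBundle n M)) 0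
      (ContinuousLinearMap.smulRight (1 : ℝ →L[ℝ] ℝ) ((0, fibreCoord J.1 U) :
        EuclideanSpace ℝ (Fin n) × (EuclideanSpace ℝ (Fin n) →L[ℝ] EuclideanSpace ℝ (Fin n)))) := by
  refine ⟨?_, ?_⟩
  · have h1 := FiberBundle.continuous_totalSpaceMk
      (F := EuclideanSpace ℝ (Fin n) →L[ℝ] EuclideanSpace ℝ (Fin n))
      (E := fun p : M => TangentSpace (𝓡 n) p →L[ℝ] TangentSpace (𝓡 n) p) J.1
    have h2 : Continuous fun t : ℝ => J.2 + t • U := by fun_prop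
    exact (h1.comp h2).continuousAt
  · have hfun : writtenInExtChartAt 𝓘(ℝ, ℝ) (modelEnd n) (0 : ℝ)
        (fun t : ℝ => (⟨J.1, J.2 + t • U⟩ : EndBundle n M)) =
        fun t : ℝ => (extChartAt (𝓡 n) J.1 J.1, fibreCoord J.1 J.2 + t • fibreCoord J.1 U) := by
      funext t
      have : fibreCoord J.1 J.2 + t • fibreCoord J.1 U = fibreCoord J.1 (J.2 + t • U) := by simp
      rw [this]
      simp only [writtenInExtChartAt, mfld_simps, FiberBundle.chartedSpace_chartAt]
      rfl
    rw [hfun]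
    refine HasFDerivAt.hasFDerivWithinAt ?_
    have h1 : HasFDerivAt (fun t : ℝ => fibreCoord J.1 J.2 + t • fibreCoord J.1 U)
        (ContinuousLinearMap.smulRight (1 : ℝ →L[ℝ] ℝ) (fibreCoord J.1 U)) (0 : ℝ) :=
      ((hasFDerivAt_id (0 : ℝ)).smul_const (fibreCoord J.1 U)).const_add _
    have h2 := (hasFDerivAt_const (𝕜 := ℝ) (extChartAt (𝓡 n) J.1 J.1) (0 : ℝ)).prodMk h1
    exact h2.congr_fderiv (ContinuousLinearMap.ext fun t => Prod.ext (smul_zero t).symm rfl)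

theorem vertLift_eq (J : EndBundle n M)
    (U : TangentSpace (𝓡 n) J.1 →L[ℝ] TangentSpace (𝓡 n) J.1) :
    vertLift J U = ((0, fibreCoord J.1 U) :
        EuclideanSpace ℝ (Fin n) × (EuclideanSpace ℝ (Fin n) →L[ℝ] EuclideanSpace ℝ (Fin n))) := by
  rw [vertLift, (hasMFDerivAt_vert J U).mfderiv]
  exact one_smul ℝ _

/-- The vertical lift as a linear map. -/
noncomputable def vertLiftₗ (J : EndBundle n M) :
    (TangentSpace (𝓡 n) J.1 →L[ℝ] TangentSpace (𝓡 n) J.1) →ₗ[ℝ] TangentSpace (modelEnd n) J where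
  toFun := vertLift J
  map_add' U V := by
    rw [vertLift_eq, vertLift_eq, vertLift_eq, map_add]
    exact Prod.ext (add_zero _).symm rfl
  map_smul' c U := by
    rw [vertLift_eq, vertLift_eq, map_smul]
    exact Prod.ext (smul_zero _).symm rfl

theorem vertLiftₗ_injective (J : EndBundle n M) : Function.Injective (vertLiftₗ J) := by
  intro U V h
  have h1 : vertLift J U = vertLift J V := h
  rw [vertLift_eq, vertLift_eq] at h1
  have h2 : fibreCoord J.1 U = fibreCoord J.1 V := (Prod.mk.inj h1).2
  exact (fibreCoord J.1).injective h2

/-- The differential of the bundle projection at `J`. -/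
noncomputable def projDeriv (J : EndBundle n M) :
    TangentSpace (modelEnd n) J →L[ℝ] TangentSpace (𝓡 n) J.1 :=
  mfderiv (modelEnd n) (𝓡 n) (fun A : EndBundle n M => A.1) J

theorem mdifferentiableAt_proj (J : EndBundle n M) :
    MDifferentiableAt (modelEnd n) (𝓡 n) (fun A : EndBundle n M => A.1) J :=
  (contMDiff_proj (n := 1) (fun p : M => TangentSpace (𝓡 n) p →L[ℝ] TangentSpace (𝓡 n) p)
    ).mdifferentiableAt one_ne_zero

theorem projDeriv_velocity (J : EndBundle n M)
    (U : TangentSpace (𝓡 n) J.1 →L[ℝ] TangentSpace (𝓡 n) J.1) (A : EndBundle n M)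
    (hA : (⟨J.1, J.2 + (0 : ℝ) • U⟩ : EndBundle n M) = A) :
    mfderiv (modelEnd n) (𝓡 n) (fun A : EndBundle n M => A.1) A (vertLift J U) =
      (0 : EuclideanSpace ℝ (Fin n)) := by
  subst hA
  have h1 := (hasMFDerivAt_vert J U).mdifferentiableAt
  have h2 : MDifferentiableAt (modelEnd n) (𝓡 n) (fun A : EndBundle n M => A.1)
    ((fun t : ℝ => (⟨J.1, J.2 + t • U⟩ : EndBundle n M)) 0) := mdifferentiableAt_proj _
  have h3 := mfderiv_comp_apply (0 : ℝ) h2 h1 (1 : ℝ)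
  have h4 : (fun A : EndBundle n M => A.1) ∘ (fun t : ℝ => (⟨J.1, J.2 + t • U⟩ : EndBundle n M))
    = fun _ => J.1 := rfl
  rw [h4, mfderiv_const] at h3
  exact h3.symm

theorem projDeriv_vertLift (J : EndBundle n M)
    (U : TangentSpace (𝓡 n) J.1 →L[ℝ] TangentSpace (𝓡 n) J.1) :
    projDeriv J (vertLift J U) = 0 := by
  exact projDeriv_velocity J U J (by simp)

/-- The section of `Hom(TM, TM)` which extends `J` and is constant in a local trivialization
around `π(J)`. -/
noncomputable def endExtend (J : EndBundle n M) (q : M) :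
    TangentSpace (𝓡 n) q →L[ℝ] TangentSpace (𝓡 n) q :=
  FiberBundle.extend (E := fun p : M => TangentSpace (𝓡 n) p →L[ℝ] TangentSpace (𝓡 n) p)
    (EuclideanSpace ℝ (Fin n) →L[ℝ] EuclideanSpace ℝ (Fin n)) J.2 q

theorem endExtend_self (J : EndBundle n M) : endExtend J J.1 = J.2 :=
  FiberBundle.extend_apply_self (E := fun p : M => TangentSpace (𝓡 n) p →L[ℝ] TangentSpace (𝓡 n) p)
    (EuclideanSpace ℝ (Fin n) →L[ℝ] EuclideanSpace ℝ (Fin n)) J.2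

theorem endDiffAt_endExtend (J : EndBundle n M) : EndDiffAt (endExtend J) J.1 :=
  mdifferentiableAt_extend (V := fun p : M => TangentSpace (𝓡 n) p →L[ℝ] TangentSpace (𝓡 n) p)
    (𝓡 n) (EuclideanSpace ℝ (Fin n) →L[ℝ] EuclideanSpace ℝ (Fin n)) J.2

/-- The differential `S_*` at `p = π(J)` of the section `S` extending `J` in a local
trivialization of `Hom(TM, TM)`. -/
noncomputable def extendDeriv (J : EndBundle n M) :
    TangentSpace (𝓡 n) J.1 →L[ℝ] TangentSpace (modelEnd n) J :=
  mfderiv (𝓡 n) (modelEnd n) (fun q => (⟨q, endExtend J q⟩ : EndBundle n M)) J.1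

theorem projDeriv_section (S : Π p : M, TangentSpace (𝓡 n) p →L[ℝ] TangentSpace (𝓡 n) p) {p : M}
    (hS : EndDiffAt S p) (A : EndBundle n M) (hA : (⟨p, S p⟩ : EndBundle n M) = A)
    (X : TangentSpace (𝓡 n) p) :
    mfderiv (modelEnd n) (𝓡 n) (fun A : EndBundle n M => A.1) A
      (mfderiv (𝓡 n) (modelEnd n) (fun q => (⟨q, S q⟩ : EndBundle n M)) p X) =
      (X : EuclideanSpace ℝ (Fin n)) := by
  subst hA
  have h2 : MDifferentiableAt (modelEnd n) (𝓡 n) (fun A : EndBundle n M => A.1)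
    ((fun q => (⟨q, S q⟩ : EndBundle n M)) p) := mdifferentiableAt_proj _
  have h3 := mfderiv_comp_apply p h2 hS X
  have h4 : (fun A : EndBundle n M => A.1) ∘ (fun q => (⟨q, S q⟩ : EndBundle n M)) = id := rfl
  rw [h4, mfderiv_id] at h3
  exact h3.symm

theorem projDeriv_extendDeriv (J : EndBundle n M) (X : TangentSpace (𝓡 n) J.1) :
    projDeriv J (extendDeriv J X) = X :=
  projDeriv_section (endExtend J) (endDiffAt_endExtend J) J (by rw [endExtend_self]) X

/-- The horizontal lift `X ↦ X^h_J`, determined by `S_* X = X^h_J + ∇_X S` for a section `S` of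
`Hom(TM, TM)` with `S(p) = J`, the second summand being a vertical vector. -/
noncomputable def horLift (g : RMetric n M) (J : EndBundle n M) :
    TangentSpace (𝓡 n) J.1 →ₗ[ℝ] TangentSpace (modelEnd n) J :=
  (extendDeriv J).toLinearMap - vertLiftₗ J ∘ₗ endNabla g (endExtend J) J.1

theorem projDeriv_horLift (g : RMetric n M) (J : EndBundle n M) (X : TangentSpace (𝓡 n) J.1) :
    projDeriv J (horLift g J X) = X := by
  have h : horLift g J X = extendDeriv J X - vertLift J (endNabla g (endExtend J) J.1 X) := rfl
  rw [h, ContinuousLinearMap.map_sub, projDeriv_extendDeriv, projDeriv_vertLift, sub_zero]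

theorem horVert_injective (g : RMetric n M) (J : EndBundle n M) :
    Function.Injective ((horLift g J).coprod (vertLiftₗ J)) := by
  rw [← LinearMap.ker_eq_bot, LinearMap.ker_eq_bot']
  rintro ⟨X, U⟩ h
  rw [LinearMap.coprod_apply] at h
  have h0 : horLift g J X + vertLiftₗ J U = 0 := h
  have h1 := congrArg (projDeriv J) h0
  have h2 : projDeriv J (vertLiftₗ J U) = 0 := projDeriv_vertLift J U
  rw [ContinuousLinearMap.map_add, projDeriv_horLift, h2, ContinuousLinearMap.map_zero,
    add_zero] at h1
  subst h1
  rw [LinearMap.map_zero, zero_add] at h0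
  have hU : U = 0 := vertLiftₗ_injective J (by rw [h0, LinearMap.map_zero])
  rw [hU]
  rfl

/-- The splitting of the tangent space of `Hom(TM, TM)` at `J` into horizontal and vertical parts:
`(X, U)` corresponds to `X^h_J + U`. -/
noncomputable def horVert (g : RMetric n M) (J : EndBundle n M) :
    (TangentSpace (𝓡 n) J.1 × (TangentSpace (𝓡 n) J.1 →L[ℝ] TangentSpace (𝓡 n) J.1)) ≃ₗ[ℝ]
      TangentSpace (modelEnd n) J :=
  have : FiniteDimensional ℝ (TangentSpace (𝓡 n) J.1 →L[ℝ] TangentSpace (𝓡 n) J.1) :=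
    inferInstanceAs (FiniteDimensional ℝ (EuclideanSpace ℝ (Fin n) →L[ℝ] EuclideanSpace ℝ (Fin n)))
  have : FiniteDimensional ℝ (TangentSpace (modelEnd n) J) :=
    inferInstanceAs (FiniteDimensional ℝ
      (EuclideanSpace ℝ (Fin n) × (EuclideanSpace ℝ (Fin n) →L[ℝ] EuclideanSpace ℝ (Fin n))))
  LinearEquiv.ofInjectiveOfFinrankEq ((horLift g J).coprod (vertLiftₗ J)) (horVert_injective g J)
    rfl

theorem horVert_apply (g : RMetric n M) (J : EndBundle n M) (X : TangentSpace (𝓡 n) J.1)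
    (U : TangentSpace (𝓡 n) J.1 →L[ℝ] TangentSpace (𝓡 n) J.1) :
    horVert g J (X, U) = horLift g J X + vertLift J U := rfl

/-! ### The twistor space and its Eells-Salamon almost complex structure -/

/-- A linear map `J` (with `J² = -1`) on an oriented real vector space of even dimension induces the
orientation `o` if `o` is the orientation of a basis of the form `e₁, J e₁, e₂, J e₂, …`. -/
def InducesOrientation {V : Type*} [AddCommGroup V] [Module ℝ V] (o : Orientation ℝ V (Fin n))
    (J : V → V) : Prop :=
  ∃ b : Module.Basis (Fin n) ℝ V, b.orientation = o ∧
    ∀ i j : Fin n, Even i.val → j.val = i.val + 1 → b j = J (b i)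

/-- An orientation of `M`: an orientation of each tangent space, such that around each point it is
given by a smooth local frame. -/
structure ManifoldOrientation (n : ℕ) (M : Type*) [TopologicalSpace M]
    [ChartedSpace (EuclideanSpace ℝ (Fin n)) M] [IsManifold (𝓡 n) ∞ M] where
  /-- The orientation of each tangent space. -/
  orient : Π p : M, Orientation ℝ (TangentSpace (𝓡 n) p) (Fin n)
  exists_frame : ∀ p : M, ∃ s : Fin n → Π q : M, TangentSpace (𝓡 n) q,
    (∀ i, ContMDiffAt (𝓡 n) ((𝓡 n).prod 𝓘(ℝ, EuclideanSpace ℝ (Fin n))) ∞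
      (fun q => TotalSpace.mk' (EuclideanSpace ℝ (Fin n)) q (s i q)) p) ∧
    ∀ᶠ q in nhds p, ∃ b : Module.Basis (Fin n) ℝ (TangentSpace (𝓡 n) q),
      (∀ i, b i = s i q) ∧ b.orientation = orient q

/-- The (positive) twistor space of the oriented Riemannian manifold `(M, g)`, as a subset of
`Hom(TM, TM)`: the `g`-orthogonal complex structures on the tangent spaces of `M` which induce the
orientation of `M`. -/
def twistorSpace (g : RMetric n M) (o : ManifoldOrientation n M) : Set (EndBundle n M) :=
  {J | (∀ v, J.2 (J.2 v) = -v) ∧ (∀ v w, g.inner J.1 (J.2 v) (J.2 w) = g.inner J.1 v w) ∧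
    InducesOrientation (o.orient J.1) J.2}

/-- The tangent space at `J` of the fibre of the twistor space: the `g`-skew-symmetric
endomorphisms anti-commuting with `J`. -/
def fibreTangent (g : RMetric n M) (J : EndBundle n M) :
    Submodule ℝ (TangentSpace (𝓡 n) J.1 →L[ℝ] TangentSpace (𝓡 n) J.1) where
  carrier := {U | (∀ v w, g.inner J.1 (U v) w = -g.inner J.1 v (U w)) ∧
    ∀ v, U (J.2 v) = -J.2 (U v)}
  add_mem' := by
    rintro U V ⟨hU, hU'⟩ ⟨hV, hV'⟩
    refine ⟨fun v w => ?_, fun v => ?_⟩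
    · simp only [_root_.add_apply, map_add, hU, hV]
      ring
    · simp only [_root_.add_apply, map_add, hU', hV']
      abel
  zero_mem' := by
    refine ⟨fun v w => ?_, fun v => ?_⟩ <;> simp
  smul_mem' := by
    rintro c U ⟨hU, hU'⟩
    refine ⟨fun v w => ?_, fun v => ?_⟩
    · simp only [_root_.smul_apply, map_smul, hU, smul_eq_mul]
      ring
    · simp only [_root_.smul_apply, map_smul, hU', smul_neg]

/-- The tangent space of the twistor space at `J`: the direct sum of the horizontal space at `J`
and the tangent space at `J` of the fibre. -/
noncomputable def twistorTangent (g : RMetric n M) (J : EndBundle n M) :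
    Submodule ℝ (TangentSpace (modelEnd n) J) :=
  ((⊤ : Submodule ℝ (TangentSpace (𝓡 n) J.1)).prod (fibreTangent g J)).map
    (horVert g J).toLinearMap

/-- The Eells-Salamon almost complex structure at `J`: `X^h_J + U ↦ (J X)^h_J - J U`. -/
noncomputable def eellsSalamon (g : RMetric n M) (J : EndBundle n M) :
    TangentSpace (modelEnd n) J →ₗ[ℝ] TangentSpace (modelEnd n) J :=
  (horVert g J).toLinearMap ∘ₗ
    (LinearMap.prodMap (J.2 : TangentSpace (𝓡 n) J.1 →ₗ[ℝ] TangentSpace (𝓡 n) J.1)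
      { toFun := fun U : TangentSpace (𝓡 n) J.1 →L[ℝ] TangentSpace (𝓡 n) J.1 => -(J.2 ∘L U)
        map_add' := fun U V => by ext; simp; abel
        map_smul' := fun c U => by ext; simp }) ∘ₗ
    (horVert g J).symm.toLinearMap

theorem eellsSalamon_horVert (g : RMetric n M) (J : EndBundle n M) (X : TangentSpace (𝓡 n) J.1)
    (U : TangentSpace (𝓡 n) J.1 →L[ℝ] TangentSpace (𝓡 n) J.1) :
    eellsSalamon g J (horVert g J (X, U)) = horVert g J (J.2 X, -(J.2 ∘L U)) := by
  rw [eellsSalamon]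
  simp only [LinearMap.comp_apply, LinearEquiv.coe_coe, LinearEquiv.symm_apply_apply]
  rfl

theorem eellsSalamon_mem (g : RMetric n M) (o : ManifoldOrientation n M) {J : EndBundle n M}
    (hJ : J ∈ twistorSpace g o) {ξ : TangentSpace (modelEnd n) J} (hξ : ξ ∈ twistorTangent g J) :
    eellsSalamon g J ξ ∈ twistorTangent g J := by
  obtain ⟨⟨X, U⟩, ⟨-, hU⟩, rfl⟩ := hξ
  obtain ⟨h1, h2, -⟩ := hJ
  refine ⟨(J.2 X, -(J.2 ∘L U)), ⟨trivial, fun v w => ?_, fun v => ?_⟩,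
    (eellsSalamon_horVert g J X U).symm⟩
  · have h3 : ∀ v w, g.inner J.1 (J.2 v) w = -g.inner J.1 v (J.2 w) := by
      intro v w
      have := h2 v (J.2 w)
      rw [h1, map_neg] at this
      linarith
    have h4 : J.2 (U w) = -U (J.2 w) := by rw [hU.2, neg_neg]
    simp only [_root_.neg_apply, ContinuousLinearMap.comp_apply, map_neg]
    rw [h3, hU.1, h4, map_neg]
  · have := hU.2 v
    simp [this]

theorem eellsSalamon_sq (g : RMetric n M) (o : ManifoldOrientation n M) {J : EndBundle n M}
    (hJ : J ∈ twistorSpace g o) (ξ : TangentSpace (modelEnd n) J) :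
    eellsSalamon g J (eellsSalamon g J ξ) = -ξ := by
  obtain ⟨⟨X, U⟩, rfl⟩ := (horVert g J).surjective ξ
  have h : (J.2 (J.2 X), -(J.2 ∘L (-(J.2 ∘L U)))) = -(X, U) := by
    refine Prod.ext (hJ.1 X) (ContinuousLinearMap.ext fun v => ?_)
    simp [hJ.1]
  rw [eellsSalamon_horVert, eellsSalamon_horVert, h]
  exact (horVert g J).toLinearMap.map_neg (X, U)

/-! ### The natural map between two twistor spaces -/

/-- The endomorphism `C` with `g(C X, Y) = g'(X, Y)`. -/
noncomputable def relEndo (g g' : RMetric n M) (p : M) :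
    TangentSpace (𝓡 n) p →ₗ[ℝ] TangentSpace (𝓡 n) p :=
  (flat g p).symm.toLinearMap ∘ₗ (g'.inner p).toLinearMap

theorem inner_relEndo (g g' : RMetric n M) (p : M) (v w : TangentSpace (𝓡 n) p) :
    g.inner p (relEndo g g' p v) w = g'.inner p v w :=
  congrArg (fun φ : TangentSpace (𝓡 n) p →L[ℝ] ℝ => φ w) (inner_flat_symm g p (g'.inner p v))

theorem existsUnique_sqrt_relEndo (g g' : RMetric n M) (p : M) :
    ∃! Q : TangentSpace (𝓡 n) p →ₗ[ℝ] TangentSpace (𝓡 n) p,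
      (∀ v w, g.inner p (Q v) w = g.inner p v (Q w)) ∧ (∀ v, v ≠ 0 → 0 < g.inner p (Q v) v) ∧
      Q ∘ₗ Q = relEndo g g' p :=
  existsUnique_sqrt (ContinuousLinearMap.coeLM ℝ ∘ₗ (g.inner p).toLinearMap) (g.symm p) (g.pos p)
    (relEndo g g' p)
    (fun v w => by
      change g.inner p (relEndo g g' p v) w = g.inner p v (relEndo g g' p w)
      rw [inner_relEndo, g.symm p v, inner_relEndo, g'.symm p])
    (fun v hv => by
      change 0 < g.inner p (relEndo g g' p v) v
      rw [inner_relEndo]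
      exact g'.pos p v hv)

/-- The principal square root `Q` of `C`: the unique `g`-symmetric positive endomorphism with
`Q² = C`. -/
noncomputable def relSqrtₗ (g g' : RMetric n M) (p : M) :
    TangentSpace (𝓡 n) p →ₗ[ℝ] TangentSpace (𝓡 n) p :=
  (existsUnique_sqrt_relEndo g g' p).choose

theorem relSqrtₗ_spec (g g' : RMetric n M) (p : M) :
    (∀ v w, g.inner p (relSqrtₗ g g' p v) w = g.inner p v (relSqrtₗ g g' p w)) ∧
    (∀ v, v ≠ 0 → 0 < g.inner p (relSqrtₗ g g' p v) v) ∧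
    relSqrtₗ g g' p ∘ₗ relSqrtₗ g g' p = relEndo g g' p :=
  (existsUnique_sqrt_relEndo g g' p).choose_spec.1

theorem relSqrtₗ_det_pos (g g' : RMetric n M) (p : M) : 0 < LinearMap.det (relSqrtₗ g g' p) :=
  det_pos_of_symm_pos (ContinuousLinearMap.coeLM ℝ ∘ₗ (g.inner p).toLinearMap) (g.symm p) (g.pos p)
    _ (relSqrtₗ_spec g g' p).1 (relSqrtₗ_spec g g' p).2.1

/-- The principal square root `Q` as an automorphism of the tangent space. -/
noncomputable def relSqrt (g g' : RMetric n M) (p : M) :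
    TangentSpace (𝓡 n) p ≃L[ℝ] TangentSpace (𝓡 n) p :=
  (LinearMap.equivOfDetNeZero (relSqrtₗ g g' p) (relSqrtₗ_det_pos g g' p).ne').toContinuousLinearEquiv

theorem relSqrt_apply (g g' : RMetric n M) (p : M) (v : TangentSpace (𝓡 n) p) :
    relSqrt g g' p v = relSqrtₗ g g' p v := rfl

theorem inner_relSqrt (g g' : RMetric n M) (p : M) (v w : TangentSpace (𝓡 n) p) :
    g.inner p (relSqrt g g' p v) (relSqrt g g' p w) = g'.inner p v w := by
  obtain ⟨h1, -, h3⟩ := relSqrtₗ_spec g g' p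
  rw [relSqrt_apply, relSqrt_apply, ← h1, ← inner_relEndo g g', ← h3]
  rfl

/-- The map `Ψ(A) = Q⁻¹ A Q` of `Hom(TM, TM)` into itself. -/
noncomputable def twistorMap (g g' : RMetric n M) (A : EndBundle n M) : EndBundle n M :=
  ⟨A.1, (relSqrt g g' A.1).symm.toContinuousLinearMap ∘L A.2 ∘L
    (relSqrt g g' A.1).toContinuousLinearMap⟩

theorem twistorMap_mapsTo (g g' : RMetric n M) (o : ManifoldOrientation n M) :
    Set.MapsTo (twistorMap g g') (twistorSpace g o) (twistorSpace g' o) := by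
  rintro J ⟨h1, h2, b, hb, hJ⟩
  set Q := relSqrt g g' J.1 with hQ
  refine ⟨fun (v : TangentSpace (𝓡 n) J.1) => ?_, fun (v w : TangentSpace (𝓡 n) J.1) => ?_,
    b.map Q.symm.toLinearEquiv, ?_, fun i j hi hj => ?_⟩
  · change Q.symm (J.2 (Q (Q.symm (J.2 (Q v))))) = -v
    rw [Q.apply_symm_apply, h1, map_neg, Q.symm_apply_apply]
  · change g'.inner J.1 (Q.symm (J.2 (Q v))) (Q.symm (J.2 (Q w))) = g'.inner J.1 v w
    rw [← inner_relSqrt g g', ← inner_relSqrt g g', ← hQ, Q.apply_symm_apply, Q.apply_symm_apply,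
      h2]
  · refine Eq.trans ?_ hb
    have hdet : 0 < LinearMap.det (Q.toLinearEquiv : TangentSpace (𝓡 n) J.1 →ₗ[ℝ] _) :=
      relSqrtₗ_det_pos g g' J.1
    refine (b.orientation_comp_linearEquiv_eq_iff_det_pos Q.symm.toLinearEquiv).2 ?_
    have h3 := LinearEquiv.det_symm_mul_det Q.toLinearEquiv
    exact pos_of_mul_pos_left (h3 ▸ one_pos) hdet.le
  · change Q.symm (b j) = Q.symm (J.2 (Q (Q.symm (b i))))
    rw [Q.apply_symm_apply, hJ i j hi hj]

/-- A smooth map `Φ` of `Hom(TM, TM)` maps the twistor space of `(M, g)` into that of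
`(M, g')`, and is holomorphic there: its differential, restricted to the tangent spaces of the
twistor space, commutes with the Eells-Salamon almost complex structures. -/
structure IsHolomorphicES (g g' : RMetric n M) (o : ManifoldOrientation n M)
    (Φ : EndBundle n M → EndBundle n M) : Prop where
  mapsTo : Set.MapsTo Φ (twistorSpace g o) (twistorSpace g' o)
  contMDiff : ContMDiff (modelEnd n) (modelEnd n) ∞ Φ
  comm : ∀ J ∈ twistorSpace g o, ∀ ξ ∈ twistorTangent g J,
    mfderiv (modelEnd n) (modelEnd n) Φ J (eellsSalamon g J ξ) =
      eellsSalamon g' (Φ J) (mfderiv (modelEnd n) (modelEnd n) Φ J ξ)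

/-- The anti-holomorphic maps: the differential anti-commutes with the Eells-Salamon almost complex
structures. -/
structure IsAntiholomorphicES (g g' : RMetric n M) (o : ManifoldOrientation n M)
    (Φ : EndBundle n M → EndBundle n M) : Prop where
  mapsTo : Set.MapsTo Φ (twistorSpace g o) (twistorSpace g' o)
  contMDiff : ContMDiff (modelEnd n) (modelEnd n) ∞ Φ
  anticomm : ∀ J ∈ twistorSpace g o, ∀ ξ ∈ twistorTangent g J,
    mfderiv (modelEnd n) (modelEnd n) Φ J (eellsSalamon g J ξ) =
      -eellsSalamon g' (Φ J) (mfderiv (modelEnd n) (modelEnd n) Φ J ξ)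

end Metric
end TwistorGeometry

/-!
The natural map `Ψ(J) = Q⁻¹ J Q` covers the identity of `M`. Projection of the equation
`dΨ(𝒥₂ X^h) = ± 𝒥₂' dΨ(X^h)` to `M` therefore gives `J X = ± Ψ(J) X`, that is, `Q J = ± J Q` for
all `J` in the twistor space (`commute_of_isHolomorphicES`, `anticommute_of_isAntiholomorphicES`).

The minus sign is impossible, as it gives `g(Q J v, J v) = -g(Q v, v)` although `Q` is positive.

In the holomorphic case, any two vectors of an orthonormal eigenbasis of `Q` are, up to sign,
related by some `J` in the fibre, so `Q` has only one eigenvalue (`eq_smul_of_commute`). Hence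
`g' = u g` for a function `u`, and `Ψ = id`. Holomorphicity now says that the almost complex
structures of `g` and `g'` agree. The horizontal lifts of `X` at `J` for `g` and `g'` differ by the
vertical vector `A_X = ∇'_X S - ∇_X S`, where `S` is a section with `S(p) = J`, so it follows that
`A_{J X} = -J A_X` (`endNabla_sub_of_eellsSalamon_eq`). The Koszul formula expresses `A` by `du`
(`endNabla_conformal`). For `y` the gradient of `u`, and `v` orthogonal to `y` and `J y`, comparison
of `g(A_{J v} y, v)` with `g(-J A_v y, v)` gives `|y|² |v|² = -|y|² |v|²`. In dimension greater than
two there is such a `v ≠ 0`, so that `du = 0` (`eq_zero_of_conformal_tensor`), and `u` is constant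
because `M` is connected.

Conversely, homothetic metrics have the same Levi-Civita connection, hence the same twistor space
and the same almost complex structure (`eellsSalamon_eq_of_homothetic`), and `Ψ = id`.
-/

namespace TwistorGeometry

/-! ### Orthogonal complex structures on an oriented Euclidean vector space -/

section LinearAlgebra

/-- The complex structure of an orthonormal basis: it maps `b₀ ↦ b₁ ↦ -b₀`, `b₂ ↦ b₃ ↦ -b₂`, … -/
theorem exists_orthogonal_complexStructure_of_basis {n : ℕ} (hn : Even n) {V : Type*}
    [NormedAddCommGroup V] [InnerProductSpace ℝ V] (b : OrthonormalBasis (Fin n) ℝ V) :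
    ∃ J : V →ₗ[ℝ] V, (∀ v, J (J v) = -v) ∧ (∀ v w, inner ℝ (J v) (J w) = inner ℝ v w) ∧
      ∀ i j : Fin n, Even i.val → j.val = i.val + 1 → b j = J (b i) := by
  let τ : Fin n → Fin n := fun i =>
    if h : Even i.val then ⟨i.val + 1, by
      have := i.2
      obtain ⟨a, ha⟩ := hn
      obtain ⟨c, hc⟩ := h
      omega⟩
    else ⟨i.val - 1, by omega⟩
  let ε : Fin n → ℝ := fun i => if Even i.val then 1 else -1
  have hodd : ∀ i : Fin n, ¬ Even i.val → Even (i.val - 1) ∧ i.val - 1 + 1 = i.val := by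
    intro i hi
    obtain ⟨c, hc⟩ := Nat.not_even_iff_odd.1 hi
    exact ⟨⟨c, by omega⟩, by omega⟩
  have hττ : ∀ i, τ (τ i) = i := by
    intro i
    by_cases h : Even i.val
    · have h' : ¬ Even (i.val + 1) := by simpa [Nat.even_add_one] using h
      ext
      simp [τ, h, h']
    · ext
      simp [τ, h, hodd i h]
  have hετ : ∀ i, ε (τ i) = -ε i := by
    intro i
    by_cases h : Even i.val
    · have h' : ¬ Even (i.val + 1) := by simpa [Nat.even_add_one] using h
      simp [τ, ε, h, h']
    · simp [τ, ε, h, hodd i h]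
  have hεε : ∀ i, ε i * ε i = 1 := by
    intro i
    by_cases h : Even i.val <;> simp [ε, h]
  let J : V →ₗ[ℝ] V := b.toBasis.constr ℝ (fun i => ε i • b (τ i))
  have hJb : ∀ i, J (b i) = ε i • b (τ i) := by
    intro i
    have := b.toBasis.constr_basis ℝ (fun i => ε i • b (τ i)) i
    rwa [OrthonormalBasis.coe_toBasis] at this
  have hJorth : Orthonormal ℝ (J ∘ b.toBasis) := by
    have hτ : Function.Injective τ := (show Function.Involutive τ from hττ).injective
    refine (b.orthonormal.comp τ hτ).orthonormal_of_forall_eq_or_eq_neg fun i => ?_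
    simp only [Function.comp_apply, OrthonormalBasis.coe_toBasis, hJb]
    by_cases h : Even i.val <;> simp [ε, h]
  refine ⟨J, fun v => ?_, fun v w => ?_, fun i j hi hj => ?_⟩
  · have h : J ∘ₗ J = -LinearMap.id := by
      refine b.toBasis.ext fun i => ?_
      simp only [OrthonormalBasis.coe_toBasis, LinearMap.comp_apply, hJb, map_smul, smul_smul, hττ,
        hετ, mul_neg, hεε]
      simp
    exact congrArg (fun f : V →ₗ[ℝ] V => f v) h
  · have hb : Orthonormal ℝ b.toBasis := by simp
    exact (J.isometryOfOrthonormal hb hJorth).inner_map_map v w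
  · have h : τ i = j := by
      ext
      simp [τ, hi, hj]
    simp [hJb, h, ε, hi]

/-- Any two distinct vectors of an orthonormal basis are, up to sign, related by an orthogonal
complex structure inducing a prescribed orientation. -/
theorem exists_orthogonal_complexStructure {n : ℕ} (hn : Even n) {V : Type*}
    [NormedAddCommGroup V] [InnerProductSpace ℝ V] (o : Orientation ℝ V (Fin n))
    (b : OrthonormalBasis (Fin n) ℝ V) {i j : Fin n} (hij : i ≠ j) :
    ∃ J : V →ₗ[ℝ] V, (∀ v, J (J v) = -v) ∧ (∀ v w, inner ℝ (J v) (J w) = inner ℝ v w) ∧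
      InducesOrientation o J ∧ (J (b i) = b j ∨ J (b i) = -b j) := by
  have h2 : 2 ≤ n := by
    have := Fin.val_ne_iff.2 hij
    obtain ⟨a, ha⟩ := hn
    omega
  let z : Fin n := ⟨0, by omega⟩
  let s : Fin n := ⟨1, by omega⟩
  have hzs : z ≠ s := by simp [z, s]
  -- a permutation with `0 ↦ i` and `1 ↦ j`
  let σ : Equiv.Perm (Fin n) := Equiv.swap (Equiv.swap z i s) j * Equiv.swap z i
  have hσs : σ s = j := by simp [σ]
  have hσz : σ z = i := by
    have h1 : i ≠ Equiv.swap z i s := by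
      intro h
      have : Equiv.swap z i z = Equiv.swap z i s := by rw [Equiv.swap_apply_left]; exact h
      exact hzs ((Equiv.swap z i).injective this)
    simp only [σ, Equiv.Perm.mul_apply, Equiv.swap_apply_left]
    exact Equiv.swap_apply_of_ne_of_ne h1 hij
  have : Nonempty (Fin n) := ⟨z⟩
  let c := (b.reindex σ.symm).adjustToOrientation o
  have hc : ∀ k, c k = b (σ k) ∨ c k = -b (σ k) := by
    intro k
    simpa using (b.reindex σ.symm).adjustToOrientation_apply_eq_or_eq_neg o k
  obtain ⟨J, hJ1, hJ2, hJ3⟩ := exists_orthogonal_complexStructure_of_basis hn c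
  refine ⟨J, hJ1, hJ2, ⟨c.toBasis, OrthonormalBasis.orientation_adjustToOrientation _ _, ?_⟩, ?_⟩
  · simpa using hJ3
  · have h := hJ3 z s (by simp [z]) (by simp [z, s])
    have h0 := hc z
    have h1 := hc s
    rw [hσz] at h0
    rw [hσs] at h1
    rcases h0 with h0 | h0 <;> rcases h1 with h1 | h1 <;> rw [h0, h1] at h
    · exact Or.inl h.symm
    · exact Or.inr h.symm
    · rw [map_neg] at h
      exact Or.inr (by rw [h, neg_neg])
    · rw [map_neg] at h
      exact Or.inl (neg_injective h.symm)

theorem exists_inducesOrientation_of_inner {n : ℕ} (hn : Even n) (hn2 : 2 ≤ n) {V : Type*}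
    [NormedAddCommGroup V] [InnerProductSpace ℝ V] [FiniteDimensional ℝ V]
    (hV : Module.finrank ℝ V = n) (o : Orientation ℝ V (Fin n)) :
    ∃ J : V →ₗ[ℝ] V, (∀ v, J (J v) = -v) ∧ (∀ v w, inner ℝ (J v) (J w) = inner ℝ v w) ∧
      InducesOrientation o J := by
  obtain ⟨J, h1, h2, h3, -⟩ := exists_orthogonal_complexStructure hn o
    ((stdOrthonormalBasis ℝ V).reindex (finCongr hV)) (i := ⟨0, by omega⟩) (j := ⟨1, by omega⟩)
    (by simp)
  exact ⟨J, h1, h2, h3⟩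

/-- All eigenvalues `μ i` agree: if `J b_i = ± b_j`, then `J Q b_i = Q J b_i` gives `μ i = μ j`. -/
theorem eq_smul_of_commute_of_inner {n : ℕ} (hn : Even n) {V : Type*}
    [NormedAddCommGroup V] [InnerProductSpace ℝ V] [FiniteDimensional ℝ V]
    (hV : Module.finrank ℝ V = n) (o : Orientation ℝ V (Fin n)) (Q : V →ₗ[ℝ] V)
    (hQ : Q.IsSymmetric)
    (hcomm : ∀ J : V →ₗ[ℝ] V, (∀ v, J (J v) = -v) →
      (∀ v w, inner ℝ (J v) (J w) = inner ℝ v w) → InducesOrientation o J →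
      ∀ v, Q (J v) = J (Q v)) :
    ∃ c : ℝ, ∀ v, Q v = c • v := by
  set b := hQ.eigenvectorBasis hV
  set μ := hQ.eigenvalues hV
  have hQb : ∀ i, Q (b i) = μ i • b i := fun i => hQ.apply_eigenvectorBasis hV i
  have hμ : ∀ i j, μ i = μ j := by
    intro i j
    by_cases hij : i = j
    · rw [hij]
    obtain ⟨J, h1, h2, h3, h4⟩ := exists_orthogonal_complexStructure hn o b hij
    have h := hcomm J h1 h2 h3 (b i)
    have hb : b j ≠ 0 := b.orthonormal.ne_zero j
    have h5 : μ j • b j = μ i • b j := by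
      rw [hQb, map_smul] at h
      rcases h4 with h4 | h4
      · rwa [h4, hQb] at h
      · rw [h4, map_neg, hQb, smul_neg] at h
        exact neg_injective h
    exact (smul_left_injective ℝ hb h5).symm
  rcases Nat.eq_zero_or_pos n with rfl | hpos
  · have : Subsingleton V := Module.finrank_zero_iff.1 hV
    exact ⟨0, fun v => Subsingleton.elim _ _⟩
  · refine ⟨μ ⟨0, hpos⟩, fun v => ?_⟩
    have h : Q = μ ⟨0, hpos⟩ • LinearMap.id := by
      refine b.toBasis.ext fun i => ?_
      simp [hQb, hμ i ⟨0, hpos⟩]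
    rw [h]
    rfl

/-- The inner product given by a positive definite symmetric bilinear form. -/
@[reducible]
def coreOfForm {V : Type*} [AddCommGroup V] [Module ℝ V]
    (B : V →ₗ[ℝ] V →ₗ[ℝ] ℝ) (hB : ∀ v w, B v w = B w v) (hBpos : ∀ v, v ≠ 0 → 0 < B v v) :
    InnerProductSpace.Core ℝ V where
  inner v w := B v w
  conj_inner_symm v w := hB w v
  re_inner_nonneg v := by
    by_cases h : v = 0
    · simp [h]
    · exact (hBpos v h).le
  add_left u v w := by simp
  smul_left u v r := by simp
  definite v h := by
    by_contra h0
    exact (hBpos v h0).ne' h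

theorem exists_inducesOrientation {n : ℕ} (hn : Even n) (hn2 : 2 ≤ n) {V : Type*}
    [AddCommGroup V] [Module ℝ V] [FiniteDimensional ℝ V]
    (hV : Module.finrank ℝ V = n) (o : Orientation ℝ V (Fin n))
    (B : V →ₗ[ℝ] V →ₗ[ℝ] ℝ) (hB : ∀ v w, B v w = B w v) (hBpos : ∀ v, v ≠ 0 → 0 < B v v) :
    ∃ J : V →ₗ[ℝ] V, (∀ v, J (J v) = -v) ∧ (∀ v w, B (J v) (J w) = B v w) ∧
      InducesOrientation o J := by
  let _ : NormedAddCommGroup V := (coreOfForm B hB hBpos).toNormedAddCommGroup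
  let _ : InnerProductSpace ℝ V := InnerProductSpace.ofCore (coreOfForm B hB hBpos).toCore
  exact exists_inducesOrientation_of_inner hn hn2 hV o

/-- A symmetric operator commuting with all the orthogonal complex structures that induce a given
orientation is a multiple of the identity. -/
theorem eq_smul_of_commute {n : ℕ} (hn : Even n) {V : Type*}
    [AddCommGroup V] [Module ℝ V] [FiniteDimensional ℝ V]
    (hV : Module.finrank ℝ V = n) (o : Orientation ℝ V (Fin n))
    (B : V →ₗ[ℝ] V →ₗ[ℝ] ℝ) (hB : ∀ v w, B v w = B w v) (hBpos : ∀ v, v ≠ 0 → 0 < B v v)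
    (Q : V →ₗ[ℝ] V) (hQ : ∀ v w, B (Q v) w = B v (Q w))
    (hcomm : ∀ J : V →ₗ[ℝ] V, (∀ v, J (J v) = -v) →
      (∀ v w, B (J v) (J w) = B v w) → InducesOrientation o J → ∀ v, Q (J v) = J (Q v)) :
    ∃ c : ℝ, ∀ v, Q v = c • v := by
  let _ : NormedAddCommGroup V := (coreOfForm B hB hBpos).toNormedAddCommGroup
  let _ : InnerProductSpace ℝ V := InnerProductSpace.ofCore (coreOfForm B hB hBpos).toCore
  exact eq_smul_of_commute_of_inner hn hV o Q hQ hcomm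

theorem exists_ne_zero_forall_two_eq_zero {V : Type*} [AddCommGroup V] [Module ℝ V]
    [FiniteDimensional ℝ V] (hV : 2 < Module.finrank ℝ V) (α β : V →ₗ[ℝ] ℝ) :
    ∃ v, v ≠ 0 ∧ α v = 0 ∧ β v = 0 := by
  have h : LinearMap.ker (α.prod β) ≠ ⊥ :=
    LinearMap.ker_ne_bot_of_finrank_lt (by simpa using hV)
  obtain ⟨v, hv, hv0⟩ := (Submodule.ne_bot_iff _).1 h
  have h1 : (α v, β v) = 0 := hv
  exact ⟨v, hv0, (Prod.mk_eq_zero.1 h1).1, (Prod.mk_eq_zero.1 h1).2⟩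

/-- The tensor `T v y w = α(v) B(y, w) + α(y) B(v, w) - α(w) B(v, y)`, with which the Levi-Civita
connection changes under a conformal change of `B`, does not satisfy the hypothesis for a nonzero
covector `α` if the dimension is greater than two: for `y` the vector dual to `α` and
`w = v` orthogonal to `y` and `J y`, the two sides are `α(y) B(v, v)` and `-α(y) B(v, v)`. -/
theorem eq_zero_of_conformal_tensor {V : Type*} [AddCommGroup V] [Module ℝ V]
    [FiniteDimensional ℝ V] (hV : 2 < Module.finrank ℝ V)
    (B : V →ₗ[ℝ] V →ₗ[ℝ] ℝ) (hB : ∀ v w, B v w = B w v) (hBpos : ∀ v, v ≠ 0 → 0 < B v v)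
    (J : V →ₗ[ℝ] V) (hJ : ∀ v, J (J v) = -v) (hJB : ∀ v w, B (J v) (J w) = B v w)
    (N : V)
    (hT : ∀ v y w,
      (B N (J v) * B (J y) w + B N (J y) * B (J v) w - B N w * B (J v) (J y)) +
      (B N (J v) * B y (J w) + B N y * B (J v) (J w) - B N (J w) * B (J v) y) =
      (B N v * B (J y) (J w) + B N (J y) * B v (J w) - B N (J w) * B v (J y)) -
      (B N v * B y w + B N y * B v w - B N w * B v y)) :
    N = 0 := by
  by_contra hN
  obtain ⟨v, hv, h1, h2⟩ := exists_ne_zero_forall_two_eq_zero hV (B N) (B (J N))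
  have hskew : ∀ v w, B (J v) w = -B v (J w) := by
    intro v w
    have := hJB v (J w)
    rw [hJ, map_neg] at this
    linarith
  have h3 : B N (J v) = 0 := by
    have := hskew N v
    linarith
  have h4 : B N (J N) = 0 := by
    have := hskew N N
    rw [hB (J N) N] at this
    linarith
  have h := hT v N v
  rw [h1, h3, h4, hJB v v] at h
  have := mul_pos (hBpos N hN) (hBpos v hv)
  linarith

end LinearAlgebra

/-! ### Functions with vanishing differential -/

theorem eq_of_mfderiv_eq_zero {E : Type*} [NormedAddCommGroup E] [NormedSpace ℝ E]
    {H : Type*} [TopologicalSpace H] {I : ModelWithCorners ℝ E H} [I.Boundaryless]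
    {M : Type*} [TopologicalSpace M] [ChartedSpace H M] [IsManifold I 1 M] [PreconnectedSpace M]
    {F : Type*} [NormedAddCommGroup F] [NormedSpace ℝ F] {u : M → F}
    (hu : MDifferentiable I 𝓘(ℝ, F) u) (hu0 : ∀ p, mfderiv I 𝓘(ℝ, F) u p = 0) (p q : M) :
    u p = u q := by
  refine IsLocallyConstant.apply_eq_of_preconnectedSpace
    ((IsLocallyConstant.iff_eventually_eq u).2 fun p => ?_) p q
  set e := extChartAt I p
  have ht : IsOpen e.target := isOpen_extChartAt_target (I := I) p
  obtain ⟨r, hr, hball⟩ := Metric.isOpen_iff.1 ht (e p) (mem_extChartAt_target (I := I) p)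
  have hd : ∀ y ∈ Metric.ball (e p) r, HasFDerivAt (u ∘ e.symm) (0 : E →L[ℝ] F) y := by
    intro y hy
    have h1 : MDifferentiableAt 𝓘(ℝ, E) I e.symm y :=
      ((contMDiffOn_extChartAt_symm (I := I) (n := 1) p).contMDiffAt
        (ht.mem_nhds (hball hy))).mdifferentiableAt one_ne_zero
    have h2 := (hu (e.symm y)).hasMFDerivAt.comp y h1.hasMFDerivAt
    rw [hu0, ContinuousLinearMap.zero_comp] at h2
    exact h2.hasFDerivAt
  have hconst : ∀ y ∈ Metric.ball (e p) r, (u ∘ e.symm) y = (u ∘ e.symm) (e p) := fun y hy =>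
    (convex_ball (e p) r).is_const_of_fderivWithin_eq_zero (𝕜 := ℝ)
      (fun z hz => (hd z hz).differentiableAt.differentiableWithinAt)
      (fun z hz => by
        rw [fderivWithin_of_isOpen Metric.isOpen_ball hz]
        exact (hd z hz).fderiv) hy (Metric.mem_ball_self hr)
  filter_upwards [(continuousAt_extChartAt (I := I) p).preimage_mem_nhds (Metric.ball_mem_nhds _ hr),
    extChartAt_source_mem_nhds (I := I) p] with q hq hq'
  have h := hconst _ hq
  rwa [Function.comp_apply, Function.comp_apply, e.left_inv hq',
    e.left_inv (mem_extChartAt_source (I := I) p)] at h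

section Metric

open Bundle VectorField FiberBundle

theorem finrank_tangent {n : ℕ} {M : Type*} [TopologicalSpace M]
    [ChartedSpace (EuclideanSpace ℝ (Fin n)) M] (p : M) :
    Module.finrank ℝ (TangentSpace (𝓡 n) p) = n :=
  finrank_euclideanSpace_fin (𝕜 := ℝ) (n := n)

variable {n : ℕ} {M : Type*} [TopologicalSpace M]
    [ChartedSpace (EuclideanSpace ℝ (Fin n)) M] [IsManifold (𝓡 n) ∞ M]

/-! ### Conformal change of the Levi-Civita connection -/

/-- The inner product on the tangent space as a bilinear form without topology. -/
noncomputable def innerForm (g : RMetric n M) (p : M) :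
    TangentSpace (𝓡 n) p →ₗ[ℝ] TangentSpace (𝓡 n) p →ₗ[ℝ] ℝ :=
  ContinuousLinearMap.coeLM ℝ ∘ₗ (g.inner p).toLinearMap

theorem d_conformal_inner {g g' : RMetric n M} {u : M → ℝ}
    (h : ∀ (q : M) (v w : TangentSpace (𝓡 n) q), g'.inner q v w = u q * g.inner q v w) {p : M}
    (hu : MDifferentiableAt (𝓡 n) 𝓘(ℝ) u p) {X Y : Π p : M, TangentSpace (𝓡 n) p}
    (hX : DiffAt X p) (hY : DiffAt Y p) :
    mvfderiv (𝓡 n) (fun q => g'.inner q (X q) (Y q)) p =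
      u p • mvfderiv (𝓡 n) (fun q => g.inner q (X q) (Y q)) p +
        g.inner p (X p) (Y p) • mvfderiv (𝓡 n) u p := by
  have h1 : (fun q => g'.inner q (X q) (Y q)) = fun q => u q * g.inner q (X q) (Y q) :=
    funext fun q => h q _ _
  rw [h1]
  exact mvfderiv_fun_mul hu (mdifferentiableAt_inner g hX hY)

theorem koszul_conformal {g g' : RMetric n M} {u : M → ℝ}
    (h : ∀ (q : M) (v w : TangentSpace (𝓡 n) q), g'.inner q v w = u q * g.inner q v w) {p : M}
    (hu : MDifferentiableAt (𝓡 n) 𝓘(ℝ) u p) {X Y Z : Π p : M, TangentSpace (𝓡 n) p}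
    (hX : DiffAt X p) (hY : DiffAt Y p) (hZ : DiffAt Z p) :
    koszul g' X Y Z p = u p * koszul g X Y Z p +
      (mvfderiv (𝓡 n) u p (X p) * g.inner p (Y p) (Z p) +
        mvfderiv (𝓡 n) u p (Y p) * g.inner p (X p) (Z p) -
        mvfderiv (𝓡 n) u p (Z p) * g.inner p (X p) (Y p)) := by
  simp only [koszul, d_conformal_inner h hu hX hY, d_conformal_inner h hu hX hZ,
    d_conformal_inner h hu hY hZ]
  simp only [h, _root_.add_apply, _root_.smul_apply, smul_eq_mul]
  ring

/-- The change of the Levi-Civita connection under a conformal change `g' = u g` of the metric. -/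
theorem inner_nabla_conformal {g g' : RMetric n M} {u : M → ℝ}
    (h : ∀ (q : M) (v w : TangentSpace (𝓡 n) q), g'.inner q v w = u q * g.inner q v w) {p : M}
    (hu : MDifferentiableAt (𝓡 n) 𝓘(ℝ) u p) {Y : Π p : M, TangentSpace (𝓡 n) p}
    (hY : DiffAt Y p) (v w : TangentSpace (𝓡 n) p) :
    2 * u p * g.inner p (leviCivita g' Y p v) w = 2 * u p * g.inner p (leviCivita g Y p v) w +
      (mvfderiv (𝓡 n) u p v * g.inner p (Y p) w + mvfderiv (𝓡 n) u p (Y p) * g.inner p v w -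
        mvfderiv (𝓡 n) u p w * g.inner p v (Y p)) := by
  change 2 * u p * g.inner p (nabla g' Y p v) w = 2 * u p * g.inner p (nabla g Y p v) w + _
  have h1 := inner_nabla g' Y p v w
  rw [h] at h1
  have hX : DiffAt (extend (EuclideanSpace ℝ (Fin n)) v) p := mdifferentiableAt_extend ..
  have hZ : DiffAt (extend (EuclideanSpace ℝ (Fin n)) w) p := mdifferentiableAt_extend ..
  have h2 := koszul_conformal h hu hX hY hZ
  rw [← koszulForm_apply g' hX hY hZ, ← koszulForm_apply g hX hY hZ] at h2
  simp only [extend_apply_self] at h2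
  rw [mul_assoc, h1, mul_assoc, inner_nabla, h2]
  ring

/-- The change of `∇S` under `g' = u g`, for `S` skew-symmetric at `p`. Twice `u` times the difference
`∇' - ∇` is the tensor `T v y w = du(v) g(y, w) + du(y) g(v, w) - du(w) g(v, y)` of
`inner_nabla_conformal`, so that `∇'S - ∇S` is `T v (S y) w + T v y (S w)`. -/
theorem endNabla_conformal {g g' : RMetric n M} {u : M → ℝ}
    (h : ∀ (q : M) (v w : TangentSpace (𝓡 n) q), g'.inner q v w = u q * g.inner q v w) {p : M}
    (hu : MDifferentiableAt (𝓡 n) 𝓘(ℝ) u p)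
    {S : Π p : M, TangentSpace (𝓡 n) p →L[ℝ] TangentSpace (𝓡 n) p} (hS : EndDiffAt S p)
    (hskew : ∀ v w, g.inner p (S p v) w = -g.inner p v (S p w)) (v y w : TangentSpace (𝓡 n) p) :
    2 * u p * g.inner p (endNabla g' S p v y - endNabla g S p v y) w =
      (mvfderiv (𝓡 n) u p v * g.inner p (S p y) w + mvfderiv (𝓡 n) u p (S p y) * g.inner p v w -
        mvfderiv (𝓡 n) u p w * g.inner p v (S p y)) +
      (mvfderiv (𝓡 n) u p v * g.inner p y (S p w) + mvfderiv (𝓡 n) u p y * g.inner p v (S p w) -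
        mvfderiv (𝓡 n) u p (S p w) * g.inner p v y) := by
  set Y := extend (EuclideanSpace ℝ (Fin n)) y with hYdef
  have hY : DiffAt Y p := mdifferentiableAt_extend ..
  have hy : Y p = y := by simp [hYdef]
  have hSY : DiffAt (fun q => S q (Y q)) p := MDifferentiableAt.clm_bundle_apply hS hY
  have h1 := inner_nabla_conformal h hu hSY v w
  have h2 := inner_nabla_conformal h hu hY v (S p w)
  rw [hy] at h1 h2
  have h3 := endNabla_apply g hS hY v
  have h4 := endNabla_apply g' hS hY v
  rw [hy] at h3 h4
  rw [h3, h4]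
  simp only [map_sub, _root_.sub_apply, hskew] at h1 ⊢
  linear_combination h1 + h2

/-! ### Homothetic metrics -/

theorem leviCivita_eq_of_homothetic {g g' : RMetric n M} {c : ℝ} (hc : c ≠ 0)
    (h : ∀ (q : M) (v w : TangentSpace (𝓡 n) q), g'.inner q v w = c * g.inner q v w) (p : M)
    {Y : Π p : M, TangentSpace (𝓡 n) p} (hY : DiffAt Y p) :
    leviCivita g' Y p = leviCivita g Y p := by
  ext1 v
  refine ext_inner g p fun w => ?_
  have h1 := inner_nabla_conformal (u := fun _ => c) h mdifferentiableAt_const hY v w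
  have h0 : mvfderiv (𝓡 n) (fun _ : M => c) p = 0 := by
    exact mvfderiv_const (I := 𝓡 n) c
  simp only [h0, _root_.zero_apply, zero_mul, add_zero, sub_zero] at h1
  exact mul_left_cancel₀ (mul_ne_zero two_ne_zero hc) h1

theorem endNabla_eq_of_homothetic {g g' : RMetric n M} {c : ℝ} (hc : c ≠ 0)
    (h : ∀ (q : M) (v w : TangentSpace (𝓡 n) q), g'.inner q v w = c * g.inner q v w) {p : M}
    {S : Π p : M, TangentSpace (𝓡 n) p →L[ℝ] TangentSpace (𝓡 n) p} (hS : EndDiffAt S p) :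
    endNabla g' S p = endNabla g S p := by
  ext v y
  set Y := extend (EuclideanSpace ℝ (Fin n)) y with hYdef
  have hY : DiffAt Y p := mdifferentiableAt_extend ..
  have hy : Y p = y := by simp [hYdef]
  have hSY : DiffAt (fun q => S q (Y q)) p := MDifferentiableAt.clm_bundle_apply hS hY
  rw [← hy, endNabla_apply g hS hY, endNabla_apply g' hS hY, leviCivita_eq_of_homothetic hc h p hY,
    leviCivita_eq_of_homothetic hc h p hSY]

theorem eellsSalamon_eq_of_homothetic {g g' : RMetric n M} {c : ℝ} (hc : c ≠ 0)
    (h : ∀ (q : M) (v w : TangentSpace (𝓡 n) q), g'.inner q v w = c * g.inner q v w)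
    (J : EndBundle n M) : eellsSalamon g' J = eellsSalamon g J := by
  have h1 : horLift g' J = horLift g J := by
    rw [horLift, horLift, endNabla_eq_of_homothetic hc h (endDiffAt_endExtend J)]
  have h2 : horVert g' J = horVert g J := by
    refine LinearEquiv.ext fun ⟨X, U⟩ => ?_
    rw [horVert_apply, horVert_apply, h1]
  rw [eellsSalamon, eellsSalamon, h2]

theorem twistorSpace_eq_of_homothetic {g g' : RMetric n M} {c : ℝ} (hc : c ≠ 0)
    (h : ∀ (q : M) (v w : TangentSpace (𝓡 n) q), g'.inner q v w = c * g.inner q v w)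
    (o : ManifoldOrientation n M) : twistorSpace g o = twistorSpace g' o := by
  ext J
  simp only [twistorSpace, Set.mem_ofPred_eq, h, mul_right_inj' hc]

/-! ### The differential of the natural map between the twistor spaces -/

/-- If `Q` is a multiple of the identity at each point, then `Ψ` is the identity, on the whole
of `Hom(TM, TM)`. -/
theorem twistorMap_eq_id {g g' : RMetric n M}
    (hQ : ∀ p : M, ∃ c : ℝ, ∀ v, relSqrtₗ g g' p v = c • v) : twistorMap g g' = id := by
  funext ⟨p, A⟩
  obtain ⟨c, hc⟩ := hQ p
  have h : (relSqrt g g' p).symm.toContinuousLinearMap ∘L A ∘L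
      (relSqrt g g' p).toContinuousLinearMap = A := by
    refine ContinuousLinearMap.ext fun v => (relSqrt g g' p).injective ?_
    change relSqrt g g' p ((relSqrt g g' p).symm (A (relSqrt g g' p v))) = relSqrt g g' p (A v)
    rw [ContinuousLinearEquiv.apply_symm_apply, relSqrt_apply, relSqrt_apply, hc, hc, map_smul]
  exact congrArg (TotalSpace.mk p) h

/-- `Ψ` covers the identity of `M`. -/
theorem projDeriv_mfderiv_twistorMap (g g' : RMetric n M) (J : EndBundle n M)
    (hd : MDifferentiableAt (modelEnd n) (modelEnd n) (twistorMap g g') J)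
    (ξ : TangentSpace (modelEnd n) J) :
    projDeriv (twistorMap g g' J) (mfderiv (modelEnd n) (modelEnd n) (twistorMap g g') J ξ) =
      projDeriv J ξ :=
  (mfderiv_comp_apply J (mdifferentiableAt_proj (twistorMap g g' J)) hd ξ).symm

theorem projDeriv_eellsSalamon (g : RMetric n M) (J : EndBundle n M)
    (ξ : TangentSpace (modelEnd n) J) :
    projDeriv J (eellsSalamon g J ξ) = J.2 (projDeriv J ξ) := by
  obtain ⟨⟨X, U⟩, rfl⟩ := (horVert g J).surjective ξ
  rw [eellsSalamon_horVert, horVert_apply, horVert_apply, ContinuousLinearMap.map_add,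
    ContinuousLinearMap.map_add, projDeriv_horLift, projDeriv_horLift, projDeriv_vertLift,
    projDeriv_vertLift, add_zero, add_zero]

theorem horLift_mem_twistorTangent (g : RMetric n M) (J : EndBundle n M)
    (X : TangentSpace (𝓡 n) J.1) : horLift g J X ∈ twistorTangent g J := by
  refine ⟨(X, 0), ⟨trivial, zero_mem _⟩, ?_⟩
  have h : horLift g J X + vertLiftₗ J 0 = horLift g J X := by rw [map_zero, add_zero]
  exact h

/-- Equality of the almost complex structures of two metrics on the `g`-horizontal vectors at `J`:
the horizontal lifts of `X` at `J` differ by the vertical vector `A_X = ∇'_X S - ∇_X S`, and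
comparison of the vertical parts gives `A_{J X} = -J A_X`. -/
theorem endNabla_sub_of_eellsSalamon_eq (g g' : RMetric n M) (J : EndBundle n M)
    (h : ∀ X, eellsSalamon g J (horLift g J X) = eellsSalamon g' J (horLift g J X))
    (X : TangentSpace (𝓡 n) J.1) :
    endNabla g' (endExtend J) J.1 (J.2 X) - endNabla g (endExtend J) J.1 (J.2 X) =
      -(J.2 ∘L (endNabla g' (endExtend J) J.1 X - endNabla g (endExtend J) J.1 X)) := by
  have h0 : ∀ X, horLift g J X = horVert g J (X, 0) := by
    intro X
    have : horLift g J X + vertLiftₗ J 0 = horLift g J X := by rw [map_zero, add_zero]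
    exact this.symm
  have hlift : ∀ X, horVert g J (X, 0) =
      horVert g' J (X, endNabla g' (endExtend J) J.1 X - endNabla g (endExtend J) J.1 X) := by
    intro X
    rw [← h0]
    have h2 : extendDeriv J X - vertLiftₗ J (endNabla g (endExtend J) J.1 X) =
        extendDeriv J X - vertLiftₗ J (endNabla g' (endExtend J) J.1 X) +
          vertLiftₗ J (endNabla g' (endExtend J) J.1 X - endNabla g (endExtend J) J.1 X) := by
      rw [map_sub]
      abel
    exact h2
  have h1 := h X
  rw [h0, eellsSalamon_horVert, hlift X, eellsSalamon_horVert, ContinuousLinearMap.comp_zero,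
    neg_zero, hlift] at h1
  exact congrArg Prod.snd ((horVert g' J).injective h1)

/-- Projected to `M`, the holomorphicity equation at a horizontal lift reads `J v = Ψ(J) v`. -/
theorem commute_of_isHolomorphicES {g g' : RMetric n M} {o : ManifoldOrientation n M}
    (h : IsHolomorphicES g g' o (twistorMap g g')) {J : EndBundle n M} (hJ : J ∈ twistorSpace g o)
    (v : TangentSpace (𝓡 n) J.1) :
    relSqrtₗ g g' J.1 (J.2 v) = J.2 (relSqrtₗ g g' J.1 v) := by
  have hd := (h.contMDiff J).mdifferentiableAt (by simp)
  have h1 := congrArg (projDeriv (twistorMap g g' J))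
    (h.comm J hJ _ (horLift_mem_twistorTangent g J v))
  rw [projDeriv_mfderiv_twistorMap g g' J hd, projDeriv_eellsSalamon, projDeriv_eellsSalamon,
    projDeriv_mfderiv_twistorMap g g' J hd, projDeriv_horLift] at h1
  have h2 : J.2 v = (relSqrt g g' J.1).symm (J.2 (relSqrt g g' J.1 v)) := h1
  rw [← relSqrt_apply, h2, ContinuousLinearEquiv.apply_symm_apply]
  rfl

/-- Projected to `M`, the equation of anti-holomorphicity at a horizontal lift reads
`J v = -Ψ(J) v`. -/
theorem anticommute_of_isAntiholomorphicES {g g' : RMetric n M} {o : ManifoldOrientation n M}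
    (h : IsAntiholomorphicES g g' o (twistorMap g g')) {J : EndBundle n M}
    (hJ : J ∈ twistorSpace g o) (v : TangentSpace (𝓡 n) J.1) :
    relSqrtₗ g g' J.1 (J.2 v) = -J.2 (relSqrtₗ g g' J.1 v) := by
  have hd := (h.contMDiff J).mdifferentiableAt (by simp)
  have h1 := congrArg (projDeriv (twistorMap g g' J))
    (h.anticomm J hJ _ (horLift_mem_twistorTangent g J v))
  rw [projDeriv_mfderiv_twistorMap g g' J hd, ContinuousLinearMap.map_neg, projDeriv_eellsSalamon,
    projDeriv_eellsSalamon,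
    projDeriv_mfderiv_twistorMap g g' J hd, projDeriv_horLift] at h1
  have h2 : J.2 v = -(relSqrt g g' J.1).symm (J.2 (relSqrt g g' J.1 v)) := h1
  rw [← relSqrt_apply, h2, map_neg, ContinuousLinearEquiv.apply_symm_apply]
  rfl

theorem exists_mem_twistorSpace (hn : Even n) (hn2 : 2 ≤ n) (g : RMetric n M)
    (o : ManifoldOrientation n M) (p : M) :
    ∃ J : TangentSpace (𝓡 n) p →L[ℝ] TangentSpace (𝓡 n) p,
      (⟨p, J⟩ : EndBundle n M) ∈ twistorSpace g o := by
  obtain ⟨J, h1, h2, h3⟩ := exists_inducesOrientation hn hn2 (finrank_tangent p) (o.orient p)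
    (innerForm g p) (g.symm p) (g.pos p)
  exact ⟨LinearMap.toContinuousLinearMap J, h1, h2, h3⟩

theorem exists_relSqrtₗ_eq_smul (hn : Even n) {g g' : RMetric n M} {o : ManifoldOrientation n M}
    (h : IsHolomorphicES g g' o (twistorMap g g')) (p : M) :
    ∃ c : ℝ, ∀ v, relSqrtₗ g g' p v = c • v :=
  eq_smul_of_commute hn (finrank_tangent p) (o.orient p) (innerForm g p) (g.symm p) (g.pos p) _
    (relSqrtₗ_spec g g' p).1 fun J h1 h2 h3 v =>
      commute_of_isHolomorphicES h (J := ⟨p, LinearMap.toContinuousLinearMap J⟩) ⟨h1, h2, h3⟩ v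

theorem exists_relSqrtₗ_eq_smul_of_homothetic {g g' : RMetric n M} {c : ℝ} (hc : 0 < c) {p : M}
    (h : ∀ v w : TangentSpace (𝓡 n) p, g'.inner p v w = c * g.inner p v w) :
    ∃ c : ℝ, ∀ v, relSqrtₗ g g' p v = c • v := by
  refine ⟨Real.sqrt c, fun v => ?_⟩
  have h1 : relSqrtₗ g g' p = Real.sqrt c • LinearMap.id := by
    refine (existsUnique_sqrt_relEndo g g' p).unique (relSqrtₗ_spec g g' p) ⟨?_, ?_, ?_⟩
    · intro v w
      simp
    · intro v hv
      have := mul_pos (Real.sqrt_pos.2 hc) (g.pos p v hv)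
      simpa using this
    · refine LinearMap.ext fun v => ext_inner g p fun w => ?_
      rw [inner_relEndo, h]
      simp [← mul_assoc, Real.mul_self_sqrt hc.le]
  rw [h1]
  rfl

/-! ### Holomorphicity of the natural map -/

theorem mdifferentiable_conformalFactor (hn : 0 < n) {g g' : RMetric n M} {u : M → ℝ}
    (h : ∀ (q : M) (v w : TangentSpace (𝓡 n) q), g'.inner q v w = u q * g.inner q v w) :
    MDifferentiable (𝓡 n) 𝓘(ℝ) u := by
  intro p
  have hnt : Nontrivial (TangentSpace (𝓡 n) p) :=
    Module.nontrivial_of_finrank_pos (R := ℝ) (by rw [finrank_tangent]; exact hn)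
  obtain ⟨v, hv⟩ := exists_ne (0 : TangentSpace (𝓡 n) p)
  set Y := extend (EuclideanSpace ℝ (Fin n)) v with hYdef
  have hY : DiffAt Y p := mdifferentiableAt_extend ..
  have hy : Y p = v := by simp [hYdef]
  have h0 : g.inner p (Y p) (Y p) ≠ 0 := by
    rw [hy]
    exact (g.pos p v hv).ne'
  have h1 := mdifferentiableAt_inner g hY hY
  -- near `p`, the factor is `g'(Y, Y) / g(Y, Y)`
  refine ((mdifferentiableAt_inner g' hY hY).div h1 h0).congr_of_eventuallyEq ?_
  filter_upwards [h1.continuousAt.eventually_ne h0] with q hq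
  simp only [Pi.div_apply, h]
  field_simp

theorem mvfderiv_conformalFactor_eq_zero (hn4 : 4 ≤ n) {g g' : RMetric n M}
    {u : M → ℝ} (h : ∀ (q : M) (v w : TangentSpace (𝓡 n) q), g'.inner q v w = u q * g.inner q v w)
    (hu : MDifferentiable (𝓡 n) 𝓘(ℝ) u) {o : ManifoldOrientation n M} {p : M}
    {J : TangentSpace (𝓡 n) p →L[ℝ] TangentSpace (𝓡 n) p}
    (hJ : (⟨p, J⟩ : EndBundle n M) ∈ twistorSpace g o)
    (hcomm : ∀ X, eellsSalamon g ⟨p, J⟩ (horLift g ⟨p, J⟩ X) =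
      eellsSalamon g' ⟨p, J⟩ (horLift g ⟨p, J⟩ X)) :
    mvfderiv (𝓡 n) u p = 0 := by
  set j : EndBundle n M := ⟨p, J⟩ with hj
  set S := endExtend j with hSdef
  have hS : EndDiffAt S p := endDiffAt_endExtend j
  have hSp : S p = J := endExtend_self j
  have hJ1 : ∀ v, J (J v) = -v := hJ.1
  have hJ2 : ∀ v w, g.inner p (J v) (J w) = g.inner p v w := hJ.2.1
  have hskew : ∀ v w, g.inner p (J v) w = -g.inner p v (J w) := by
    intro v w
    have := hJ2 v (J w)
    rw [hJ1, map_neg] at this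
    linarith
  have hAJ := endNabla_sub_of_eellsSalamon_eq g g' j hcomm
  -- `N` is the `g`-gradient of `u` at `p`
  set N := (flat g p).symm (mvfderiv (𝓡 n) u p) with hN
  have hNu : ∀ v, mvfderiv (𝓡 n) u p v = g.inner p N v := fun v => by
    rw [hN, inner_flat_symm]
  have key : N = 0 := by
    refine eq_zero_of_conformal_tensor (by rw [finrank_tangent]; omega) (innerForm g p) (g.symm p)
      (g.pos p) J.toLinearMap hJ1 hJ2 N fun v y w => ?_
    have e1 := endNabla_conformal h (hu p) hS (by rw [hSp]; exact hskew) (J v) y w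
    have e2 := endNabla_conformal h (hu p) hS (by rw [hSp]; exact hskew) v y (J w)
    have e3 : endNabla g' S p (J v) y - endNabla g S p (J v) y =
        -J (endNabla g' S p v y - endNabla g S p v y) :=
      congrArg (fun f : TangentSpace (𝓡 n) p →L[ℝ] TangentSpace (𝓡 n) p => f y) (hAJ v)
    -- both sides of `g(A_{J v} y, w) = g(A_v y, J w)`, multiplied by `2 u(p)`
    rw [e3, map_neg, _root_.neg_apply, hskew, neg_neg, e2] at e1
    simp only [hSp, hNu, hJ1, map_neg] at e1
    change
      (g.inner p N (J v) * g.inner p (J y) w + g.inner p N (J y) * g.inner p (J v) w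
        - g.inner p N w * g.inner p (J v) (J y)) +
      (g.inner p N (J v) * g.inner p y (J w) + g.inner p N y * g.inner p (J v) (J w)
        - g.inner p N (J w) * g.inner p (J v) y) =
      (g.inner p N v * g.inner p (J y) (J w) + g.inner p N (J y) * g.inner p v (J w)
        - g.inner p N (J w) * g.inner p v (J y)) -
      (g.inner p N v * g.inner p y w + g.inner p N y * g.inner p v w
        - g.inner p N w * g.inner p v y)
    linarith
  exact ContinuousLinearMap.ext fun v => by rw [hNu, key]; simp

theorem homothetic_of_isHolomorphicES [ConnectedSpace M] (hn : Even n) (hn4 : 4 ≤ n)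
    {g g' : RMetric n M} {o : ManifoldOrientation n M}
    (h : IsHolomorphicES g g' o (twistorMap g g')) :
    ∃ f : ℝ, ∀ (p : M) (v w : TangentSpace (𝓡 n) p),
      g'.inner p v w = Real.exp (2 * f) * g.inner p v w := by
  have hQ := exists_relSqrtₗ_eq_smul hn h
  rw [twistorMap_eq_id hQ] at h
  choose c hc using hQ
  have hconf : ∀ (q : M) (v w : TangentSpace (𝓡 n) q),
      g'.inner q v w = c q ^ 2 * g.inner q v w := by
    intro q v w
    rw [← inner_relSqrt g g', relSqrt_apply, relSqrt_apply, hc, hc]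
    simp
    ring
  have hu := mdifferentiable_conformalFactor (by omega) hconf
  have hu0 : ∀ p, mvfderiv (𝓡 n) (fun q => c q ^ 2) p = 0 := by
    intro p
    obtain ⟨J, hJ⟩ := exists_mem_twistorSpace hn (by omega) g o p
    refine mvfderiv_conformalFactor_eq_zero hn4 hconf hu hJ fun X => ?_
    have h1 := h.comm _ hJ _ (horLift_mem_twistorTangent g _ X)
    rw [mfderiv_id] at h1
    exact h1
  have hconst := eq_of_mfderiv_eq_zero hu hu0
  obtain ⟨p₀⟩ : Nonempty M := inferInstance
  have : Nontrivial (TangentSpace (𝓡 n) p₀) :=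
    Module.nontrivial_of_finrank_pos (R := ℝ) (by rw [finrank_tangent]; omega)
  obtain ⟨v, hv⟩ := exists_ne (0 : TangentSpace (𝓡 n) p₀)
  have hpos : 0 < c p₀ ^ 2 := by
    have h1 := g'.pos p₀ v hv
    rw [hconf] at h1
    exact pos_of_mul_pos_left h1 (g.pos p₀ v hv).le
  refine ⟨Real.log (c p₀ ^ 2) / 2, fun p v w => ?_⟩
  rw [mul_div_cancel₀ _ two_ne_zero, Real.exp_log hpos, hconf p, hconst p p₀]

end Metric
end TwistorGeometry

theorem mainTheorem2 {n : ℕ} (hn : Even n) (hn4 : 4 ≤ n)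
    {M : Type*} [TopologicalSpace M] [ChartedSpace (EuclideanSpace ℝ (Fin n)) M]
    [IsManifold (𝓡 n) ∞ M] [ConnectedSpace M]
    (o : TwistorGeometry.ManifoldOrientation n M) (g g' : TwistorGeometry.RMetric n M) :
    (TwistorGeometry.IsHolomorphicES g g' o (TwistorGeometry.twistorMap g g') ↔
      ∃ f : ℝ, ∀ (p : M) (v w : TangentSpace (𝓡 n) p),
        g'.inner p v w = Real.exp (2 * f) * g.inner p v w) ∧
    ((∃ f : ℝ, ∀ (p : M) (v w : TangentSpace (𝓡 n) p),
        g'.inner p v w = Real.exp (2 * f) * g.inner p v w) →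
      TwistorGeometry.twistorSpace g o = TwistorGeometry.twistorSpace g' o ∧
      ∀ J ∈ TwistorGeometry.twistorSpace g o, TwistorGeometry.twistorMap g g' J = J) ∧
    ¬ TwistorGeometry.IsAntiholomorphicES g g' o (TwistorGeometry.twistorMap g g') := by
  have hid : ∀ f : ℝ, (∀ (p : M) (v w : TangentSpace (𝓡 n) p),
      g'.inner p v w = Real.exp (2 * f) * g.inner p v w) →
      TwistorGeometry.twistorMap g g' = id := fun f hf =>
    TwistorGeometry.twistorMap_eq_id fun p =>
      TwistorGeometry.exists_relSqrtₗ_eq_smul_of_homothetic (Real.exp_pos _) (hf p)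
  refine ⟨⟨TwistorGeometry.homothetic_of_isHolomorphicES hn hn4, ?_⟩, ?_, ?_⟩
  · rintro ⟨f, hf⟩
    refine ⟨TwistorGeometry.twistorMap_mapsTo g g' o, ?_, fun J _ ξ _ => ?_⟩
    · rw [hid f hf]
      exact contMDiff_id
    · rw [hid f hf, mfderiv_id,
        TwistorGeometry.eellsSalamon_eq_of_homothetic (Real.exp_pos _).ne' hf]
      rfl
  · rintro ⟨f, hf⟩
    refine ⟨TwistorGeometry.twistorSpace_eq_of_homothetic (Real.exp_pos _).ne' hf o,
      fun J _ => ?_⟩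
    rw [hid f hf, id]
  · intro h
    obtain ⟨p⟩ : Nonempty M := inferInstance
    obtain ⟨J, hJ⟩ := TwistorGeometry.exists_mem_twistorSpace hn (by omega) g o p
    have : Nontrivial (TangentSpace (𝓡 n) p) :=
      Module.nontrivial_of_finrank_pos (R := ℝ) (by rw [TwistorGeometry.finrank_tangent]; omega)
    obtain ⟨v, hv⟩ := exists_ne (0 : TangentSpace (𝓡 n) p)
    -- `g(Q J v, J v) = -g(J Q v, J v) = -g(Q v, v)` contradicts positivity of `Q`
    have h1 : TwistorGeometry.relSqrtₗ g g' p (J v) = -J (TwistorGeometry.relSqrtₗ g g' p v) :=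
      TwistorGeometry.anticommute_of_isAntiholomorphicES h hJ v
    have hpos := (TwistorGeometry.relSqrtₗ_spec g g' p).2.1
    have hJ1 : ∀ v, J (J v) = -v := hJ.1
    have hJ2 : ∀ v w, g.inner p (J v) (J w) = g.inner p v w := hJ.2.1
    have hJv : J v ≠ 0 := by
      intro h0
      have := hJ1 v
      rw [h0, map_zero] at this
      exact hv (neg_eq_zero.1 this.symm)
    have h2 := hpos _ hJv
    rw [h1, map_neg, _root_.neg_apply, hJ2] at h2
    linarith [hpos v hv]
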